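/- A *tree* is a partially ordered set $T$ in which the set of strict predecessors of every node is well-ordered; the order type of this set is the height of the node, $T_\alpha$ is the set of nodes of height $\alpha$, and the height of $T$ is the least ordinal greater than the heights of all its nodes. A *Suslin tree* is a tree of height $\omega_1$ without uncountable chains and without uncountable antichains (sets of pairwise incomparable nodes). The *Suslin Hypothesis* says that there is no Suslin tree. A *continuum* is a nonempty compact connected Hausdorff space; it is *non-degenerate* if it has more than one point, and *Suslinian* if every family of pairwise disjoint non-degenerate subcontinua of it is countable. A surjective map $f:X\to Y$ is *irreducible* if $f(A)\neq Y$ for every proper closed subset $A\subset X$. A continuous map $f:X\to Y$ between continua is *atomic* if all its fibres $f^{-1}(y)$ are connected and nonempty and, for every non-degenerate subcontinuum $Z\subset Y$, the restriction $f^{-1}(Z)\to Z$ is irreducible; an atomic map is *$I$-atomic* if each of its fibres is a singleton or an arc (a homeomorphic copy of $[0,1]$). **Theorem.** Suppose that the Suslin Hypothesis fails. Then there is a Suslinian continuum $X$ that is hereditarily separable (every subspace of $X$ is separable) and non-metrizable, such that every non-degenerate subcontinuum of $X$ is neither metrizable nor locally connected. Moreover, $X$ can be chosen to be the limit of an inverse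 spectrum $\{X_\alpha,\pi^\beta_\alpha:\alpha\le\beta<\omega_1\}$ consisting of metrizable Suslinian continua $X_\alpha$ and atomic bonding maps $\pi^\beta_\alpha:X_\beta\to X_\alpha$, where $X_0$ is a singleton and the spectrum is continuous ($X_\alpha$ is, via the maps $\pi^\alpha_\beta$, $\beta<\alpha$, the inverse limit of $\{X_\beta,\pi_\gamma^\beta:\gamma\le\beta<\alpha\}$ for every limit ordinal $\alpha<\omega_1$), and for which there are a Suslin tree $T$ and injective maps $i_\alpha:T_\alpha\to X_\alpha$ ($\alpha<\omega_1$) such that 1. $\pi^\beta_\alpha(i_\beta(t))=i_\alpha(s)$ whenever $\alpha\le\beta<\omega_1$, $s\in T_\alpha$, $t\in T_\beta$ and $s\le t$; 2. for every $\alpha<\omega_1$ and $s\in T_\alpha$, the set $\{i_{\alpha+1}(t):t\in T_{\alpha+1},\ s<t\}$ is a dense subset of $(\pi^{\alpha+1}_\alpha)^{-1}(i_\alpha(s))$; 3. for every $\alpha<\omega_1$, the map $\pi^{\alpha+1}_\alpha$ is $I$-atomic and $\{y\in X_\alpha:|(\pi^{\alpha+1}_\alpha)^{-1}(y)|>1\}=i_\alpha(T_\alpha)$.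 -/

import Mathlib

open Set Topology TopologicalSpace
open scoped Ordinal

/-! ### Trees and the Suslin Hypothesis -/

/-- A (set-theoretic) tree: a partially ordered set in which the strict predecessors of every
node are well-ordered. -/
class IsSetTree (T : Type*) [PartialOrder T] : Prop where
  wellOrder_Iio : ∀ t : T, IsWellOrder (Set.Iio t) (· < ·)

attribute [instance] IsSetTree.wellOrder_Iio

/-- The height of a node: the order type of its set of strict predecessors. -/
noncomputable def nodeHeight {T : Type*} [PartialOrder T] [IsSetTree T] (t : T) : Ordinal :=
  Ordinal.type (fun a b : Set.Iio t => a < b)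

/-- The level of height `α` of a tree. -/
def treeLevel (T : Type*) [PartialOrder T] [IsSetTree T] (α : Ordinal) : Set T :=
  {t | nodeHeight t = α}

/-- The height of a tree: the least ordinal exceeding the heights of all nodes. -/
noncomputable def treeHeight (T : Type*) [PartialOrder T] [IsSetTree T] : Ordinal :=
  sInf {α | ∀ t : T, nodeHeight t < α}

/-- A Suslin tree: a tree of height `ω₁` with no uncountable chain and no uncountable
antichain (a set of pairwise incomparable nodes). -/
structure IsSuslinTree (T : Type*) [PartialOrder T] [IsSetTree T] : Prop where
  height_eq : treeHeight T = ω₁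
  chain_countable : ∀ C : Set T, IsChain (· ≤ ·) C → C.Countable
  antichain_countable : ∀ A : Set T, IsAntichain (· ≤ ·) A → A.Countable

/-- The Suslin Hypothesis: there is no Suslin tree. -/
def SuslinHypothesis : Prop :=
  ∀ (T : Type) [PartialOrder T] [IsSetTree T], ¬ IsSuslinTree T

/-! ### Continua -/

/-- A continuum: a (nonempty) compact connected Hausdorff space. -/
structure IsContinuum (X : Type*) [TopologicalSpace X] : Prop where
  compactSpace : CompactSpace X
  connectedSpace : ConnectedSpace X
  t2Space : T2Space X

/-- A non-degenerate subcontinuum: a subset which is a continuum in the subspace topology and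
has more than one point. -/
def IsNondegenerateSubcontinuum {X : Type*} [TopologicalSpace X] (C : Set X) : Prop :=
  IsContinuum C ∧ C.Nontrivial

/-- A Suslinian continuum: every family of pairwise disjoint non-degenerate subcontinua is
countable. -/
def IsSuslinianContinuum (X : Type*) [TopologicalSpace X] : Prop :=
  IsContinuum X ∧
    ∀ 𝒞 : Set (Set X), (∀ C ∈ 𝒞, IsNondegenerateSubcontinuum C) →
      𝒞.PairwiseDisjoint id → 𝒞.Countable

/-- Every subspace is separable. -/
def IsHereditarilySeparable (X : Type*) [TopologicalSpace X] : Prop :=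
  ∀ A : Set X, SeparableSpace A

/-! ### Atomic maps -/

/-- A surjective map is irreducible if no proper closed subset is mapped onto the target. -/
def IsIrreducibleMap {X Y : Type*} [TopologicalSpace X] (f : X → Y) : Prop :=
  Function.Surjective f ∧ ∀ A : Set X, IsClosed A → A ≠ Set.univ → f '' A ≠ Set.univ

/-- An atomic map: a continuous map with connected (nonempty) fibres whose restriction
`f ⁻¹(Z) → Z` is irreducible for every non-degenerate subcontinuum `Z` of the target. -/
structure IsAtomicMap {X Y : Type*} [TopologicalSpace X] [TopologicalSpace Y]
    (f : X → Y) : Prop where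
  continuous : Continuous f
  connected_fiber : ∀ y : Y, IsConnected (f ⁻¹' {y})
  irreducible : ∀ Z : Set Y, IsNondegenerateSubcontinuum Z →
    IsIrreducibleMap (Z.restrictPreimage f)

/-- The set of points with more than one preimage. -/
def nondegeneracySet {X Y : Type*} (f : X → Y) : Set Y :=
  {y | (f ⁻¹' {y}).Nontrivial}

/-- An `I`-atomic map: an atomic map each of whose fibres is a singleton or an arc. -/
def IsIAtomicMap {X Y : Type*} [TopologicalSpace X] [TopologicalSpace Y] (f : X → Y) : Prop :=
  IsAtomicMap f ∧
    ∀ y : Y, (∃ x : X, f ⁻¹' {y} = {x}) ∨ Nonempty ((f ⁻¹' {y} : Set X) ≃ₜ unitInterval)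

/-! ### Inverse spectra -/

/-- The space `L` with the projections `p i : L → X i` is the inverse limit of the spectrum
`(X i, π i j)`: the diagonal map of the projections is a homeomorphism of `L` onto the subspace
of threads in the product `∏ i, X i`. -/
def IsInverseLimit {I : Type*} [Preorder I] {X : I → Type*} [∀ i, TopologicalSpace (X i)]
    (π : ∀ i j : I, i ≤ j → X j → X i) {L : Type*} [TopologicalSpace L]
    (p : ∀ i, L → X i) : Prop :=
  IsEmbedding (fun (x : L) (i : I) => p i x) ∧
    Set.range (fun (x : L) (i : I) => p i x) =
      {z : ∀ i, X i | ∀ (i j : I) (h : i ≤ j), π i j h (z j) = z i}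

/-- The countable ordinals, that is, the ordinal `ω₁` as an index set. -/
abbrev CountableOrdinal : Type 1 := Set.Iio (ω₁ : Ordinal.{0})

/-- A continuous spectrum `(X α, π α β)`, `α ≤ β < ω₁`, of metrizable Suslinian continua with
atomic bonding maps, starting with a point, together with injections `ι α` of the levels of the
tree `T` into the `X α` that commute with the bonding maps and such that, at each successor step,
`π α (α + 1)` is `I`-atomic, its non-degenerate fibres are exactly those over the points `ι α t`,
and each such fibre has the image of the set of immediate successors of `t` as a dense subset. -/
structure IsTreeSpectrum (T : Type) [PartialOrder T] [IsSetTree T]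
    (X : CountableOrdinal → Type) [∀ α, TopologicalSpace (X α)]
    (π : ∀ α β : CountableOrdinal, α ≤ β → X β → X α)
    (ι : ∀ α : CountableOrdinal, treeLevel T α.1 → X α) : Prop where
  map_self : ∀ (α : CountableOrdinal) (x : X α), π α α le_rfl x = x
  map_map : ∀ (α β γ : CountableOrdinal) (h : α ≤ β) (h' : β ≤ γ) (x : X γ),
    π α β h (π β γ h' x) = π α γ (h.trans h') x
  metrizable : ∀ α, MetrizableSpace (X α)
  suslinian : ∀ α, IsSuslinianContinuum (X α)
  atomic : ∀ (α β : CountableOrdinal) (h : α ≤ β), IsAtomicMap (π α β h)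
  bottom : ∀ α : CountableOrdinal, IsMin α → Subsingleton (X α)
  limit : ∀ α : CountableOrdinal, Order.IsSuccLimit α →
    IsInverseLimit (I := Set.Iio α) (X := fun β => X β.1) (fun β γ h => π β.1 γ.1 h)
      (fun β => π β.1 α (le_of_lt β.2))
  injective : ∀ α, Function.Injective (ι α)
  commutes : ∀ (α β : CountableOrdinal) (h : α ≤ β) (s : treeLevel T α.1) (t : treeLevel T β.1),
    s.1 ≤ t.1 → π α β h (ι β t) = ι α s
  iAtomic : ∀ (α β : CountableOrdinal) (h : α ⋖ β), IsIAtomicMap (π α β h.le)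
  nondegeneracySet_eq : ∀ (α β : CountableOrdinal) (h : α ⋖ β),
    nondegeneracySet (π α β h.le) = Set.range (ι α)
  dense : ∀ (α β : CountableOrdinal) (h : α ⋖ β) (s : treeLevel T α.1),
    closure (ι β '' {t | s.1 < t.1}) = π α β h.le ⁻¹' {ι α s}

/-! ### Nodes and heights in trees -/

/-! A Suslin tree is first improved (`exists_isNormalSuslin`) so that cones are uncountable, every
node has infinitely many immediate successors ("children"), and distinct nodes with equal
predecessor sets share an immediate predecessor.

The continuum lives in the cube `[0,1]^T`. A node `s` is coded by a point `ι s` vanishing at nodes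
of height at least that of `s`. At a node `r`, a point `x` has a free coordinate only if its
truncation below the height of `r` equals `ι r`; otherwise `x r = |sin (1/d)|`, where `d` is the
distance from that truncation to `ι r`. So each successor step blows up every point `ι s` of the
level to an arc, approached by the rest of the space like the limit bar of a topologist's sine
curve, and the codes of the children of `s` are dense in that arc. A nondegenerate connected set
through `ι s` realizes all small distances to it, so its lift accumulates at the whole arc. This is
atomicity: `exists_fib_succ_subset` for one step, `exists_fib_subset` for all projections.

Consequently every nondegenerate subcontinuum contains the full fibre over some `ι t`
(`exists_node_fib_subset`): at the least height where it varies it runs along an arc, hence passes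
through the code of a child, and atomicity lifts this to the fibre. Disjoint subcontinua yield
incomparable nodes, so the Suslinian property comes from countable antichains. Fibres keep branching
at all countable heights, which excludes metrizability, and the oscillation excludes local
connectedness.

For hereditary separability (`exists_countable_dense_subset`), the trace of a set `A` on the fibre
over a node is controlled by countably many points of `A` for cofinally many nodes, hence for all
nodes of some countable height `α`. Over the remaining points of the `α`-th space, which is
metrizable, fibres are singletons. -/

lemma isAntichain_minimal {T : Type} [PartialOrder T] (G : Set T) :
    IsAntichain (· ≤ ·) {m | m ∈ G ∧ ∀ s ∈ G, s ≤ m → s = m} := by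
  intro a ha b hb hne hle
  exact hne (hb.2 a ha.1 hle)

section TreeBasics

variable {T : Type} [PartialOrder T] [IsSetTree T]

lemma nodeHeight_eq_typein {s t : T} (h : s < t) :
    nodeHeight s = Ordinal.typein (fun a b : Set.Iio t => a < b) ⟨s, h⟩ := by
  rw [← Ordinal.type_subrel]
  refine RelIso.ordinalType_congr
    ⟨⟨fun x => ⟨⟨x.1, lt_trans x.2 h⟩, x.2⟩, fun x => ⟨x.1.1, x.2⟩, fun _ => rfl, fun _ => rfl⟩, ?_⟩
  intro a b
  rfl

lemma nodeHeight_strictMono : StrictMono (nodeHeight : T → Ordinal) := by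
  intro s t h
  rw [nodeHeight_eq_typein h]
  exact Ordinal.typein_lt_type _ _

lemma exists_lt_of_lt_nodeHeight {t : T} {α : Ordinal} (h : α < nodeHeight t) :
    ∃ s, s < t ∧ nodeHeight s = α := by
  obtain ⟨s, hs⟩ := Ordinal.typein_surj (fun a b : Set.Iio t => a < b) h
  exact ⟨s.1, s.2, (nodeHeight_eq_typein s.2).trans hs⟩

lemma exists_le_of_le_nodeHeight {t : T} {α : Ordinal} (h : α ≤ nodeHeight t) :
    ∃ s, s ≤ t ∧ nodeHeight s = α := by
  rcases h.lt_or_eq with h | h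
  · obtain ⟨s, hs, hs'⟩ := exists_lt_of_lt_nodeHeight h
    exact ⟨s, hs.le, hs'⟩
  · exact ⟨t, le_rfl, h.symm⟩

lemma comparable_of_le {s s' t : T} (h : s ≤ t) (h' : s' ≤ t) : s ≤ s' ∨ s' ≤ s := by
  rcases h.lt_or_eq with h | rfl
  · rcases h'.lt_or_eq with h' | rfl
    · rcases trichotomous_of (fun a b : Set.Iio t => a < b) ⟨s, h⟩ ⟨s', h'⟩ with h1 | h1 | h1
      · exact Or.inl (le_of_lt h1)
      · exact Or.inl (le_of_eq (congrArg Subtype.val h1))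
      · exact Or.inr (le_of_lt h1)
    · exact Or.inl h.le
  · exact Or.inr h'

lemma le_of_nodeHeight_le {s s' t : T} (h : s ≤ t) (h' : s' ≤ t)
    (hh : nodeHeight s ≤ nodeHeight s') : s ≤ s' := by
  rcases comparable_of_le h h' with h1 | h1
  · exact h1
  · rcases h1.lt_or_eq with h2 | h2
    · exact absurd (nodeHeight_strictMono h2) (not_lt.2 hh)
    · exact h2.ge

lemma lt_of_nodeHeight_lt {s s' t : T} (h : s ≤ t) (h' : s' ≤ t)
    (hh : nodeHeight s < nodeHeight s') : s < s' :=
  lt_of_le_of_ne (le_of_nodeHeight_le h h' hh.le) (fun e => by simp [e] at hh)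

lemma eq_of_nodeHeight_eq {s s' t : T} (h : s ≤ t) (h' : s' ≤ t)
    (hh : nodeHeight s = nodeHeight s') : s = s' :=
  le_antisymm (le_of_nodeHeight_le h h' hh.le) (le_of_nodeHeight_le h' h hh.ge)

lemma isAntichain_treeLevel (α : Ordinal) : IsAntichain (· ≤ ·) (treeLevel T α) := by
  intro s hs t ht hne hle
  exact hne (eq_of_nodeHeight_eq hle le_rfl (hs.trans ht.symm))

lemma exists_minimal_le_mem {G : Set T} {t : T} (ht : t ∈ G) :
    ∃ m ∈ G, m ≤ t ∧ ∀ s ∈ G, s ≤ m → s = m := by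
  have hwf : WellFounded (fun a b : T => nodeHeight a < nodeHeight b) :=
    InvImage.wf nodeHeight Ordinal.lt_wf
  obtain ⟨m, ⟨hm, hmt⟩, hmin⟩ := hwf.has_min {s | s ∈ G ∧ s ≤ t} ⟨t, ht, le_rfl⟩
  refine ⟨m, hm, hmt, fun s hs hsm => ?_⟩
  by_contra hne
  exact hmin s ⟨hs, hsm.trans hmt⟩ (nodeHeight_strictMono (lt_of_le_of_ne hsm hne))

lemma countable_Iio_of_lt_omega_one {α : Ordinal.{0}} (h : α < ω₁) : (Set.Iio α).Countable := by
  rw [Cardinal.lt_omega_iff_card_lt, Cardinal.lt_aleph_one_iff] at h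
  rw [← Cardinal.le_aleph0_iff_set_countable, Cardinal.mk_Iio_ordinal, Cardinal.lift_le_aleph0]
  exact h

lemma isSetTree_subtype (p : T → Prop) : IsSetTree {t // p t} where
  wellOrder_Iio t := by
    let f : Set.Iio t → Set.Iio t.1 := fun s => ⟨s.1.1, s.2⟩
    have hf : ∀ {a b : Set.Iio t}, f a < f b ↔ a < b := Iff.rfl
    exact RelEmbedding.isWellOrder (r := fun a b : Set.Iio t => a < b)
      (s := fun a b : Set.Iio t.1 => a < b)
      ⟨⟨f, fun a b h => Subtype.ext (Subtype.ext (congrArg (fun x : Set.Iio t.1 => x.1) h))⟩, hf⟩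

/-- A nonempty tree with countable chains and antichains all of whose cones are uncountable. -/
structure IsSuslinLike (T : Type) [PartialOrder T] [IsSetTree T] : Prop where
  nonempty : Nonempty T
  chain : ∀ C : Set T, IsChain (· ≤ ·) C → C.Countable
  antichain : ∀ A : Set T, IsAntichain (· ≤ ·) A → A.Countable
  cone : ∀ t : T, ¬ (Set.Ici t).Countable

lemma nodeHeight_lt_omega_one (hc : ∀ C : Set T, IsChain (· ≤ ·) C → C.Countable) (t : T) :
    nodeHeight t < ω₁ := by
  have h : (Set.Iio t).Countable := hc _ (fun a ha b hb _ => comparable_of_le (le_of_lt ha) (le_of_lt hb))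
  rw [Cardinal.lt_omega_iff_card_lt, Cardinal.lt_aleph_one_iff]
  unfold nodeHeight
  rw [Ordinal.card_type]
  exact Cardinal.le_aleph0_iff_set_countable.2 h

lemma countable_nodeHeight_lt (ha : ∀ A : Set T, IsAntichain (· ≤ ·) A → A.Countable)
    {α : Ordinal.{0}} (h : α < ω₁) : {t : T | nodeHeight t < α}.Countable := by
  have : {t : T | nodeHeight t < α} = ⋃ β ∈ Set.Iio α, treeLevel T β := by
    ext t
    simp [treeLevel]
  rw [this]
  exact (countable_Iio_of_lt_omega_one h).biUnion fun β _ => ha _ (isAntichain_treeLevel β)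

lemma exists_bound_of_countable (hc : ∀ C : Set T, IsChain (· ≤ ·) C → C.Countable)
    {R : Set T} (hR : R.Countable) : ∃ α < ω₁, ∀ r ∈ R, nodeHeight r < α := by
  have := hR.to_subtype
  have hb : ∀ r : R, Order.succ (nodeHeight r.1) < ω₁ := fun r =>
    (Cardinal.isSuccLimit_omega 1).succ_lt (nodeHeight_lt_omega_one hc r.1)
  refine ⟨⨆ r : R, Order.succ (nodeHeight r.1), Ordinal.iSup_lt_omega_one hb, fun r hr => ?_⟩
  exact lt_of_lt_of_le (Order.lt_succ _)
    (Ordinal.le_iSup (fun r : R => Order.succ (nodeHeight r.1)) ⟨r, hr⟩)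

lemma isSuslinTree_of_uncountable (hc : ∀ C : Set T, IsChain (· ≤ ·) C → C.Countable)
    (ha : ∀ A : Set T, IsAntichain (· ≤ ·) A → A.Countable)
    (hu : ¬ (Set.univ : Set T).Countable) : IsSuslinTree T where
  height_eq := by
    apply le_antisymm
    · exact csInf_le' fun t => nodeHeight_lt_omega_one hc t
    · refine le_csInf ⟨ω₁, fun t => nodeHeight_lt_omega_one hc t⟩ fun α hα => ?_
      by_contra hlt
      refine hu ((countable_nodeHeight_lt ha (not_le.1 hlt)).mono fun t _ => hα t)
  chain_countable := hc
  antichain_countable := ha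

lemma IsSuslinTree.uncountable (h : IsSuslinTree T) : ¬ (Set.univ : Set T).Countable := by
  intro hu
  obtain ⟨α, hα, hb⟩ := exists_bound_of_countable h.chain_countable hu
  have : treeHeight T ≤ α := csInf_le' fun t => hb t trivial
  rw [h.height_eq] at this
  exact absurd hα (not_lt.2 this)

lemma IsSuslinLike.isSuslinTree (h : IsSuslinLike T) : IsSuslinTree T := by
  obtain ⟨t⟩ := h.nonempty
  exact isSuslinTree_of_uncountable h.chain h.antichain
    fun hu => h.cone t (hu.mono (subset_univ _))

/-- The cone of `t` is uncountable while the levels below `α` have countable union, so some node of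
the cone reaches height `α`. -/
lemma IsSuslinLike.exists_ge (h : IsSuslinLike T) {t : T} {α : Ordinal.{0}} (hα : α < ω₁)
    (ht : nodeHeight t ≤ α) : ∃ s, t ≤ s ∧ nodeHeight s = α := by
  have : ∃ s ∈ Set.Ici t, α ≤ nodeHeight s := by
    by_contra hcon
    push Not at hcon
    exact h.cone t ((countable_nodeHeight_lt h.antichain hα).mono hcon)
  obtain ⟨s, hs, hs'⟩ := this
  obtain ⟨r, hr, rfl⟩ := exists_le_of_le_nodeHeight hs'
  exact ⟨r, le_of_nodeHeight_le hs hr ht, rfl⟩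

end TreeBasics

/-! ### Normalizing a Suslin tree -/

/-- Discard the nodes with countable cone. They are covered by the cones of the minimal ones, which
form an antichain, so only countably many nodes are lost and the surviving cones stay uncountable.
-/
lemma IsSuslinTree.exists_isSuslinLike {T : Type} [PartialOrder T] [IsSetTree T]
    (h : IsSuslinTree T) :
    ∃ (T' : Type) (_ : PartialOrder T') (_ : IsSetTree T'), IsSuslinLike T' := by
  let p : T → Prop := fun t => ¬ (Set.Ici t).Countable
  have hcompl : {t : T | ¬ p t}.Countable := by
    let M := {m | m ∈ {t : T | ¬ p t} ∧ ∀ s ∈ {t : T | ¬ p t}, s ≤ m → s = m}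
    have hM : M.Countable := h.antichain_countable _ (isAntichain_minimal _)
    refine (hM.biUnion (t := fun m _ => Set.Ici m) fun m hm => not_not.1 hm.1).mono fun t ht => ?_
    obtain ⟨m, hm, hmt, hmin⟩ := exists_minimal_le_mem ht
    exact mem_biUnion (show m ∈ M from ⟨hm, hmin⟩) hmt
  have hmono : ∀ (A : Set {t // p t}), (Subtype.val '' A).Countable → A.Countable := fun A hA =>
    countable_of_injective_of_countable_image Subtype.val_injective.injOn hA
  have := isSetTree_subtype p
  refine ⟨{t // p t}, inferInstance, this, ?_, ?_, ?_, ?_⟩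
  · by_contra hne
    refine h.uncountable (hcompl.mono fun t _ hp => hne ⟨⟨t, hp⟩⟩)
  · intro C hC
    refine hmono C (h.chain_countable _ ?_)
    rintro _ ⟨a, ha, rfl⟩ _ ⟨b, hb, rfl⟩ hne
    exact hC ha hb fun e => hne (congrArg _ e)
  · intro A hA
    refine hmono A (h.antichain_countable _ ?_)
    rintro _ ⟨a, ha, rfl⟩ _ ⟨b, hb, rfl⟩ hne
    exact hA ha hb fun e => hne (congrArg _ e)
  · intro t ht
    refine t.2 (((ht.image Subtype.val).union hcompl).mono fun s hs => ?_)
    by_cases hp : p s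
    · exact Or.inl ⟨⟨s, hp⟩, hs, rfl⟩
    · exact Or.inr hp

/-! ### Splitting nodes and levels with infinite branching -/

section Split

variable {T : Type} [PartialOrder T] [IsSetTree T]

lemma IsSuslinLike.exists_split (h : IsSuslinLike T) (u : T) :
    ∃ v w, u ≤ v ∧ u ≤ w ∧ ¬ v ≤ w ∧ ¬ w ≤ v := by
  by_contra hcon
  push Not at hcon
  refine h.cone u (h.chain _ fun a ha b hb _ => ?_)
  by_contra hab
  rw [not_or] at hab
  exact hab.2 (hcon a b ha hb hab.1)

/-- A comb: iterating one half `r` of a split gives a spine, and the other halves `l` hanging off it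
are pairwise incomparable. -/
lemma IsSuslinLike.exists_antichain (h : IsSuslinLike T) (u : T) :
    ∃ a : ℕ → T, (∀ n, u ≤ a n) ∧ ∀ m n, a m ≤ a n → m = n := by
  choose l r hul hur hlr hrl using h.exists_split
  let v : ℕ → T := fun n => r^[n] u
  have hv : ∀ n, v (n + 1) = r (v n) := fun n => Function.iterate_succ_apply' r n u
  have hmono : Monotone v := monotone_nat_of_le_succ fun n => by rw [hv]; exact hur _
  have hlt : ∀ m n, m < n → ¬ l (v m) ≤ l (v n) ∧ ¬ l (v n) ≤ l (v m) := by
    intro m n hmn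
    have h1 : r (v m) ≤ l (v n) := by
      rw [← hv]; exact (hmono hmn).trans (hul _)
    refine ⟨fun h2 => ?_, fun h2 => hrl _ (h1.trans h2)⟩
    rcases comparable_of_le h1 h2 with h3 | h3
    · exact hrl _ h3
    · exact hlr _ h3
  refine ⟨fun n => l (v n), fun n => (hmono (Nat.zero_le n)).trans (hul _), fun m n hmn => ?_⟩
  rcases lt_trichotomy m n with h1 | h1 | h1
  · exact absurd hmn (hlt m n h1).1
  · exact h1
  · exact absurd hmn (hlt n m h1).2

/-- Level `g` is countable, so the infinite antichains above its nodes lie below one countable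
height, to which they all extend injectively. -/
lemma IsSuslinLike.exists_level_infinite (h : IsSuslinLike T) {g : Ordinal.{0}} (hg : g < ω₁) :
    ∃ e, g < e ∧ e < ω₁ ∧ ∀ u : T, nodeHeight u = g → {s | u ≤ s ∧ nodeHeight s = e}.Infinite := by
  choose a hua ha using h.exists_antichain
  have hR : (⋃ u ∈ treeLevel T g, Set.range (a u)).Countable :=
    (h.antichain _ (isAntichain_treeLevel g)).biUnion fun u _ => countable_range _
  obtain ⟨e, he, hb⟩ := exists_bound_of_countable h.chain hR
  refine ⟨max e (Order.succ g), lt_max_of_lt_right (Order.lt_succ g),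
    max_lt he ((Cardinal.isSuccLimit_omega 1).succ_lt hg), fun u hu => ?_⟩
  have hext : ∀ n, ∃ s, a u n ≤ s ∧ nodeHeight s = max e (Order.succ g) := fun n =>
    h.exists_ge (max_lt he ((Cardinal.isSuccLimit_omega 1).succ_lt hg))
      (le_max_of_le_left (hb _ (mem_biUnion (show u ∈ treeLevel T g from hu) ⟨n, rfl⟩)).le)
  choose b hab hbe using hext
  refine Set.infinite_of_injective_forall_mem (f := b) ?_ fun n => ⟨(hua u n).trans (hab n), hbe n⟩
  intro m n hmn
  have h1 := hab m
  rw [hmn] at h1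
  rcases comparable_of_le h1 (hab n) with h2 | h2
  · exact ha u _ _ h2
  · exact (ha u _ _ h2).symm

end Split

/-- The selection of heights is a well-founded recursion: `e` is selected when some `g < e` lies
strictly above all earlier selections and is related to `e` by `Q`. -/
lemma exists_sparse_levels (Q : Ordinal.{0} → Ordinal.{0} → Prop) :
    ∃ P : Ordinal.{0} → Prop, ∀ e, P e ↔ ∃ g < e, (∀ f < e, P f → f < g) ∧ Q g e := by
  let F : ∀ e : Ordinal.{0}, (∀ f, f < e → Prop) → Prop := fun e IH =>
    ∃ g < e, (∀ f, ∀ h : f < e, IH f h → f < g) ∧ Q g e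
  refine ⟨Ordinal.lt_wf.fix F, fun e => ?_⟩
  rw [WellFounded.fix_eq]

/-- Keep only the nodes at selected heights. Below a kept node, all kept predecessors lie below its
ancestor `u` at the gap height `g`, so the infinitely many nodes above `u` on the same level have
identical predecessors. -/
lemma IsSuslinLike.exists_infinite_twins {T : Type} [PartialOrder T] [IsSetTree T]
    (h : IsSuslinLike T) :
    ∃ (T' : Type) (_ : PartialOrder T') (_ : IsSetTree T'), IsSuslinLike T' ∧
      ∀ t : T', {s : T' | Set.Iio s = Set.Iio t}.Infinite := by
  obtain ⟨P, hP⟩ := exists_sparse_levels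
    fun g e => ∀ u : T, nodeHeight u = g → {s | u ≤ s ∧ nodeHeight s = e}.Infinite
  have hunb : ∀ b < ω₁, ∃ e, b ≤ e ∧ e < ω₁ ∧ P e := by
    intro b hb
    by_contra hcon
    push Not at hcon
    obtain ⟨e, hbe, he, hQ⟩ := h.exists_level_infinite hb
    -- If no countable height from `b` on were selected, `b` itself would serve as the gap for `e`.
    refine hcon e hbe.le he ((hP e).2 ⟨b, hbe, fun f hf hPf => ?_, hQ⟩)
    by_contra hfb
    exact hcon f (not_lt.1 hfb) (hf.trans he) hPf
  let p : T → Prop := fun t => P (nodeHeight t)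
  have hmono : ∀ (A : Set {t // p t}), (Subtype.val '' A).Countable → A.Countable := fun A hA =>
    countable_of_injective_of_countable_image Subtype.val_injective.injOn hA
  have hext : ∀ t : T, ∀ b < ω₁, ∃ s : {t // p t}, t ≤ s.1 ∧ b ≤ nodeHeight s.1 := by
    intro t b hb
    obtain ⟨e, hbe, he, hPe⟩ := hunb (max b (nodeHeight t))
      (max_lt hb (nodeHeight_lt_omega_one h.chain t))
    obtain ⟨s, hts, hs⟩ := h.exists_ge he ((le_max_right _ _).trans hbe)
    exact ⟨⟨s, by rw [← hs] at hPe; exact hPe⟩, hts, by rw [hs]; exact (le_max_left _ _).trans hbe⟩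
  have := isSetTree_subtype p
  refine ⟨{t // p t}, inferInstance, this, ⟨?_, ?_, ?_, ?_⟩, ?_⟩
  · obtain ⟨t⟩ := h.nonempty
    obtain ⟨s, -⟩ := hext t 0 (Ordinal.omega_pos 1)
    exact ⟨s⟩
  · intro C hC
    refine hmono C (h.chain _ ?_)
    rintro _ ⟨a, ha, rfl⟩ _ ⟨b, hb, rfl⟩ hne
    exact hC ha hb fun e => hne (congrArg _ e)
  · intro A hA
    refine hmono A (h.antichain _ ?_)
    rintro _ ⟨a, ha, rfl⟩ _ ⟨b, hb, rfl⟩ hne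
    exact hA ha hb fun e => hne (congrArg _ e)
  · intro t ht
    obtain ⟨b, hb, hbd⟩ := exists_bound_of_countable h.chain (ht.image Subtype.val)
    obtain ⟨s, hts, hs⟩ := hext t.1 b hb
    exact absurd (hbd s.1 ⟨s, hts, rfl⟩) (not_lt.2 hs)
  · intro t
    obtain ⟨g, hg, hgap, hQ⟩ := (hP _).1 t.2
    obtain ⟨u, hut, hu⟩ := exists_lt_of_lt_nodeHeight hg
    have key : ∀ s : {t // p t}, u ≤ s.1 → nodeHeight s.1 = nodeHeight t.1 →
        Set.Iio s = {r | r.1 < u} := by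
      intro s hus hs
      ext r
      refine ⟨fun hr => ?_, fun hr => lt_of_lt_of_le (show r.1 < u from hr) hus⟩
      have hr' : r.1 < s.1 := hr
      have h1 : nodeHeight r.1 < g := hgap _ (by rw [← hs]; exact nodeHeight_strictMono hr') r.2
      exact lt_of_nodeHeight_lt hr'.le hus (by rw [hu]; exact h1)
    refine (hQ u hu).preimage (f := Subtype.val) ?_ |>.mono ?_
    · rintro s ⟨-, hs⟩
      exact ⟨⟨s, by change P _; rw [hs]; exact t.2⟩, rfl⟩
    · rintro s ⟨hus, hs⟩
      exact (key s hus hs).trans (key t hut.le rfl).symm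

/-- A Suslin tree in which every cone is uncountable, every node has infinitely many immediate
successors, and distinct nodes with the same predecessors have a common immediate predecessor. -/
structure IsNormalSuslin (T : Type) [PartialOrder T] [IsSetTree T] : Prop
    extends IsSuslinLike T where
  children : ∀ t : T, {s | t ⋖ s}.Infinite
  hausdorff : ∀ s t : T, Set.Iio s = Set.Iio t → s = t ∨ ∃ r, r ⋖ s ∧ r ⋖ t

/-! ### The tree of initial segments -/

section SegmentTree

variable {T : Type} [PartialOrder T] [IsSetTree T]

lemma exists_Iio_eq_of_ssubset {r t : T} (h : Set.Iio r ⊂ Set.Iio t) :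
    ∃ s < t, Set.Iio s = Set.Iio r := by
  obtain ⟨s₀, hs₀t, hs₀r⟩ := exists_of_ssubset h
  obtain ⟨s, ⟨hst, hsr⟩, -, hmin⟩ :=
    exists_minimal_le_mem (G := {s | s < t ∧ ¬ s < r}) (show s₀ ∈ _ from ⟨hs₀t, hs₀r⟩)
  refine ⟨s, hst, Subset.antisymm (fun x hx => ?_) fun x hx => ?_⟩
  · by_contra hxr
    have hxs : x < s := hx
    exact hxs.ne (hmin x ⟨hxs.trans hst, hxr⟩ hxs.le)
  · rcases comparable_of_le (le_of_lt (h.1 hx)) hst.le with h1 | h1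
    · exact lt_of_le_of_ne h1 fun e => hsr (e ▸ hx)
    · exact absurd (lt_of_le_of_lt h1 hx) hsr

lemma Iio_ssubset_Iio_iff {s s' t : T} (h : s < t) (h' : s' < t) :
    Set.Iio s ⊂ Set.Iio s' ↔ s < s' := by
  constructor
  · intro hss
    rcases comparable_of_le h.le h'.le with h1 | h1
    · exact lt_of_le_of_ne h1 fun e => hss.ne (by rw [e])
    · exact absurd hss (not_ssubset_of_subset (Set.Iio_subset_Iio h1))
  · intro hlt
    exact (ssubset_iff_of_subset (Set.Iio_subset_Iio hlt.le)).2 ⟨s, hlt, lt_irrefl s⟩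

variable (T) in
/-- The sets of strict predecessors of nodes, ordered by inclusion. -/
abbrev SegmentTree : Type := {A : Set T // ∃ t, A = Set.Iio t}

lemma SegmentTree.exists_of_lt {A B : SegmentTree T} {t : T} (hA : A.1 = Set.Iio t) (h : B < A) :
    ∃ s < t, B.1 = Set.Iio s := by
  obtain ⟨r, hr⟩ := B.2
  have hlt : B.1 ⊂ A.1 := h
  rw [hr, hA] at hlt
  obtain ⟨s, hs, hsr⟩ := exists_Iio_eq_of_ssubset hlt
  exact ⟨s, hs, hr.trans hsr.symm⟩

instance SegmentTree.isSetTree : IsSetTree (SegmentTree T) where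
  wellOrder_Iio A := by
    obtain ⟨t, ht⟩ := A.2
    have hex : ∀ B : Set.Iio A, ∃ s < t, B.1.1 = Set.Iio s := fun B =>
      SegmentTree.exists_of_lt ht B.2
    choose f hft hf using hex
    let F : Set.Iio A → Set.Iio t := fun B => ⟨f B, hft B⟩
    have hF : ∀ {B C : Set.Iio A}, F B < F C ↔ B < C := by
      intro B C
      change f B < f C ↔ B.1.1 ⊂ C.1.1
      rw [hf B, hf C]
      exact (Iio_ssubset_Iio_iff (hft B) (hft C)).symm
    refine RelEmbedding.isWellOrder (r := fun B C : Set.Iio A => B < C)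
      (s := fun a b : Set.Iio t => a < b) ⟨⟨F, fun B C h => ?_⟩, hF⟩
    have h' : f B = f C := congrArg (fun x : Set.Iio t => x.1) h
    exact Subtype.ext (Subtype.ext ((hf B).trans (h' ▸ (hf C).symm)))

/-- Without a greatest segment strictly below it, `A` is the union of the segments strictly below
it, and these also lie below `A'`. -/
lemma SegmentTree.mem_of_forall_not_max {A A' : SegmentTree T} (h : Set.Iio A = Set.Iio A')
    (hmax : ¬ ∃ R < A, ∀ B < A, B ≤ R) : A.1 ⊆ A'.1 := by
  obtain ⟨t, ht⟩ := A.2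
  intro s hs
  have hst : s < t := by rw [ht] at hs; exact hs
  let S : SegmentTree T := ⟨Set.Iio s, s, rfl⟩
  have hSA : S < A := by
    change Set.Iio s ⊂ A.1
    rw [ht]
    exact (ssubset_iff_of_subset (Set.Iio_subset_Iio hst.le)).2 ⟨s, hst, lt_irrefl s⟩
  push Not at hmax
  obtain ⟨B, hBA, hB⟩ := hmax S hSA
  obtain ⟨t₁, ht₁, hBt₁⟩ := SegmentTree.exists_of_lt ht hBA
  have hsB : s ∈ B.1 := by
    rw [hBt₁]
    rcases comparable_of_le hst.le ht₁.le with h1 | h1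
    · refine lt_of_le_of_ne h1 fun e => hB ?_
      change B.1 ⊆ Set.Iio s
      rw [hBt₁, e]
    · refine absurd ?_ hB
      change B.1 ⊆ Set.Iio s
      rw [hBt₁]
      exact Set.Iio_subset_Iio h1
  have hBA' : B ∈ Set.Iio A' := h ▸ hBA
  exact (show B.1 ⊆ A'.1 from le_of_lt hBA') hsB

lemma SegmentTree.hausdorff (A A' : SegmentTree T) (h : Set.Iio A = Set.Iio A') :
    A = A' ∨ ∃ R, R ⋖ A ∧ R ⋖ A' := by
  by_cases hmax : ∃ R < A, ∀ B < A, B ≤ R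
  · obtain ⟨R, hR, hB⟩ := hmax
    refine Or.inr ⟨R, ⟨hR, fun B h1 h2 => (hB B h2).not_gt h1⟩,
      ⟨(h ▸ hR : R ∈ Set.Iio A'), fun B h1 h2 => ?_⟩⟩
    have : B ∈ Set.Iio A := h ▸ h2
    exact (hB B this).not_gt h1
  · refine Or.inl (Subtype.ext (Subset.antisymm (SegmentTree.mem_of_forall_not_max h hmax)
      (SegmentTree.mem_of_forall_not_max h.symm ?_)))
    rintro ⟨R, hR, hB⟩
    refine hmax ⟨R, (h ▸ hR : R ∈ Set.Iio A), fun B h1 => hB B (h ▸ h1 : B ∈ Set.Iio A')⟩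

/-- Passing to segments identifies nodes with the same predecessors. The identified nodes are not
lost: each twin `s` of `t` yields the immediate successor `Iic s` of `Iio t`, so infinitely many
twins become infinitely many children. -/
lemma SegmentTree.isNormalSuslin (h : IsSuslinLike T)
    (htw : ∀ t : T, {s : T | Set.Iio s = Set.Iio t}.Infinite) :
    IsNormalSuslin (SegmentTree T) where
  nonempty := by
    obtain ⟨t⟩ := h.nonempty
    exact ⟨⟨Set.Iio t, t, rfl⟩⟩
  chain C hC := by
    -- The union of a chain of segments is a chain of nodes. Every member of `C` except possibly a
    -- last one is the segment of a node in this union.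
    have hU : (⋃ A ∈ C, A.1).Countable := by
      refine h.chain _ fun a ha b hb _ => ?_
      simp only [mem_iUnion] at ha hb
      obtain ⟨A, hA, ha⟩ := ha
      obtain ⟨B, hB, hb⟩ := hb
      obtain ⟨D, haD, hbD⟩ : ∃ D : SegmentTree T, a ∈ D.1 ∧ b ∈ D.1 := by
        rcases hC.total hA hB with hAB | hAB
        · exact ⟨B, (show A.1 ⊆ B.1 from hAB) ha, hb⟩
        · exact ⟨A, ha, (show B.1 ⊆ A.1 from hAB) hb⟩
      obtain ⟨t, ht⟩ := D.2
      rw [ht] at haD hbD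
      exact comparable_of_le (le_of_lt haD) (le_of_lt hbD)
    have h1 : {A ∈ C | ∃ B ∈ C, A < B}.Countable := by
      refine (hU.image fun s => (⟨Set.Iio s, s, rfl⟩ : SegmentTree T)).mono ?_
      rintro A ⟨-, B, hB, hAB⟩
      obtain ⟨t, ht⟩ := B.2
      obtain ⟨s, hs, hAs⟩ := SegmentTree.exists_of_lt ht hAB
      exact ⟨s, mem_biUnion hB (by rw [ht]; exact hs), Subtype.ext hAs.symm⟩
    have h2 : {A ∈ C | ¬ ∃ B ∈ C, A < B}.Subsingleton := by
      rintro A ⟨hA, hA'⟩ B ⟨hB, hB'⟩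
      by_contra hne
      rcases hC hA hB hne with hAB | hAB
      · exact hA' ⟨B, hB, lt_of_le_of_ne hAB hne⟩
      · exact hB' ⟨A, hA, lt_of_le_of_ne hAB (Ne.symm hne)⟩
    refine (h1.union h2.countable).mono fun A hA => ?_
    by_cases hB : ∃ B ∈ C, A < B
    · exact Or.inl ⟨hA, hB⟩
    · exact Or.inr ⟨hA, hB⟩
  antichain C hC := by
    have hex : ∀ A : SegmentTree T, ∃ t, A.1 = Set.Iio t := fun A => A.2
    choose f hf using hex
    have hle : ∀ A B, f A ≤ f B → A ≤ B := fun A B hAB => by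
      change A.1 ⊆ B.1
      rw [hf A, hf B]
      exact Set.Iio_subset_Iio hAB
    have hinj : Set.InjOn f C := fun A _ B _ hAB =>
      le_antisymm (hle A B hAB.le) (hle B A hAB.ge)
    refine countable_of_injective_of_countable_image hinj (h.antichain _ ?_)
    rintro _ ⟨A, hA, rfl⟩ _ ⟨B, hB, rfl⟩ hne hAB
    exact hC hA hB (fun e => hne (by rw [e])) (hle A B hAB)
  cone A hA := by
    obtain ⟨t, ht⟩ := A.2
    refine h.cone t ((hA.biUnion (t := fun B _ => {s | Set.Iio s = B.1}) fun B _ =>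
      h.antichain _ ?_).mono fun s hs => ?_)
    · intro a ha b hb hne hab
      have ha' : Set.Iio a = B.1 := ha
      have hb' : Set.Iio b = B.1 := hb
      have : a ∈ Set.Iio b := lt_of_le_of_ne hab hne
      rw [hb', ← ha'] at this
      exact lt_irrefl a this
    · have hle : A ≤ (⟨Set.Iio s, s, rfl⟩ : SegmentTree T) := by
        change A.1 ⊆ Set.Iio s
        rw [ht]
        exact Set.Iio_subset_Iio hs
      exact mem_biUnion hle (show Set.Iio s = Set.Iio s from rfl)
  children A := by
    obtain ⟨t, ht⟩ := A.2
    -- `Iic s` belongs to the segment tree because `s` has an extension one level higher.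
    have hex : ∀ s : T, ∃ r, Set.Iic s = Set.Iio r := by
      intro s
      obtain ⟨r, hsr, hr⟩ := h.exists_ge
        ((Cardinal.isSuccLimit_omega 1).succ_lt (nodeHeight_lt_omega_one h.chain s))
        (Order.le_succ (nodeHeight s))
      have hlt : s < r := lt_of_le_of_ne hsr fun e =>
        (Order.lt_succ (nodeHeight s)).ne (by rw [← hr, ← e])
      refine ⟨r, Subset.antisymm (Set.Iic_subset_Iio.2 hlt) fun x hx => ?_⟩
      have hx' : x < r := hx
      refine le_of_nodeHeight_le hx'.le hsr (Order.lt_succ_iff.1 ?_)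
      rw [← hr]
      exact nodeHeight_strictMono hx'
    let f : T → SegmentTree T := fun s => ⟨Set.Iic s, hex s⟩
    have hf : Function.Injective f := fun a b hab => Set.Iic_injective (congrArg Subtype.val hab)
    refine ((htw t).image hf.injOn).mono ?_
    rintro _ ⟨s, hs, rfl⟩
    have hA : A.1 = Set.Iio s := ht.trans (show Set.Iio s = Set.Iio t from hs).symm
    refine ⟨?_, fun B h1 h2 => ?_⟩
    · change A.1 ⊂ Set.Iic s
      rw [hA]
      exact (ssubset_iff_of_subset Set.Iio_subset_Iic_self).2 ⟨s, le_rfl, lt_irrefl s⟩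
    · have h1' : A.1 ⊂ B.1 := h1
      have h2' : B.1 ⊂ Set.Iic s := h2
      obtain ⟨x, hxB, hxA⟩ := exists_of_ssubset h1'
      rw [hA] at hxA
      have hxs : x = s := by
        by_contra hne
        exact hxA (lt_of_le_of_ne (h2'.1 hxB) hne)
      refine h2'.not_subset fun y hy => ?_
      rcases (show y ≤ s from hy).lt_or_eq with hlt | rfl
      · exact h1'.1 (by rw [hA]; exact hlt)
      · exact hxs ▸ hxB
  hausdorff := SegmentTree.hausdorff

end SegmentTree

theorem exists_isNormalSuslin (hSH : ¬ SuslinHypothesis) :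
    ∃ (T : Type) (_ : PartialOrder T) (_ : IsSetTree T), IsNormalSuslin T := by
  unfold SuslinHypothesis at hSH
  push Not at hSH
  obtain ⟨T, _, _, hT⟩ := hSH
  obtain ⟨T₁, _, _, h₁⟩ := hT.exists_isSuslinLike
  obtain ⟨T₂, _, _, h₂, htw⟩ := h₁.exists_infinite_twins
  exact ⟨SegmentTree T₂, inferInstance, inferInstance, SegmentTree.isNormalSuslin h₂ htw⟩

/-! ### Immediate successors and branching points -/

section Normal

variable {T : Type} [PartialOrder T] [IsSetTree T]

lemma nodeHeight_of_covBy {s t : T} (h : s ⋖ t) : nodeHeight t = Order.succ (nodeHeight s) := by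
  refine le_antisymm ?_ (Order.succ_le_of_lt (nodeHeight_strictMono h.1))
  by_contra hlt
  obtain ⟨r, hr, hr'⟩ := exists_lt_of_lt_nodeHeight (not_le.1 hlt)
  exact h.2 (lt_of_nodeHeight_lt h.1.le hr.le (by rw [hr']; exact Order.lt_succ _)) hr

lemma covBy_of_nodeHeight {s t : T} (h : s < t) (hh : nodeHeight t = Order.succ (nodeHeight s)) :
    s ⋖ t :=
  ⟨h, fun r h1 h2 => by
    have h3 := nodeHeight_strictMono h2
    rw [hh, Order.lt_succ_iff] at h3
    exact absurd (nodeHeight_strictMono h1) (not_lt.2 h3)⟩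

lemma exists_covBy_le {s t : T} (h : s < t) : ∃ c, s ⋖ c ∧ c ≤ t := by
  obtain ⟨c, hc, hc'⟩ := exists_le_of_le_nodeHeight (Order.succ_le_of_lt (nodeHeight_strictMono h))
  exact ⟨c, covBy_of_nodeHeight (lt_of_nodeHeight_lt h.le hc (by rw [hc']; exact Order.lt_succ _)) hc',
    hc⟩

/-- Take `c` minimal below `s` but not below `t`, and `d` below `t` at the height of `c`. They have
the same predecessors, so the Hausdorff condition supplies the branching node. -/
lemma IsNormalSuslin.exists_branching (h : IsNormalSuslin T) {s t : T}
    (hst : nodeHeight s = nodeHeight t) (hne : s ≠ t) :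
    ∃ r c d, r ⋖ c ∧ r ⋖ d ∧ c ≤ s ∧ d ≤ t ∧ c ≠ d := by
  obtain ⟨c, ⟨hcs, hct⟩, -, hmin⟩ := exists_minimal_le_mem (G := {x | x ≤ s ∧ ¬ x ≤ t})
    (show s ∈ _ from ⟨le_rfl, fun hle => hne (eq_of_nodeHeight_eq hle le_rfl hst)⟩)
  obtain ⟨d, hdt, hd⟩ := exists_le_of_le_nodeHeight
    ((nodeHeight_strictMono.monotone hcs).trans hst.le)
  have hlt : ∀ x, x < c → x < d := by
    intro x hx
    have hxt : x ≤ t := by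
      by_contra hxt
      exact hx.ne (hmin x ⟨hx.le.trans hcs, hxt⟩ hx.le)
    exact lt_of_nodeHeight_lt hxt hdt (by rw [hd]; exact nodeHeight_strictMono hx)
  have hIio : Set.Iio c = Set.Iio d := by
    refine Subset.antisymm hlt fun x hx => ?_
    have hxd : x < d := hx
    have hx' := nodeHeight_strictMono hxd
    rw [hd] at hx'
    obtain ⟨y, hy, hyx⟩ := exists_lt_of_lt_nodeHeight hx'
    rwa [eq_of_nodeHeight_eq hxd.le (hlt y hy).le hyx.symm]
  have hcd : c ≠ d := fun e => hct (e ▸ hdt)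
  rcases h.hausdorff c d hIio with h1 | ⟨r, hrc, hrd⟩
  · exact absurd h1 hcd
  · exact ⟨r, c, d, hrc, hrd, hcs, hdt, hcd⟩

end Normal

/-! ### The oscillating function -/

/-- The function `|sin (1 / d)|`. -/
noncomputable def osc (d : ℝ) : unitInterval :=
  ⟨|Real.sin d⁻¹|, abs_nonneg _, Real.abs_sin_le_one _⟩

lemma continuousAt_osc {d : ℝ} (hd : d ≠ 0) : ContinuousAt osc d := by
  refine Topology.IsInducing.subtypeVal.continuousAt_iff.2 ?_
  exact ((Real.continuous_sin.continuousAt).comp (continuousAt_inv₀ hd)).abs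

lemma exists_osc_eq (u : unitInterval) {δ : ℝ} (hδ : 0 < δ) : ∃ r, 0 < r ∧ r < δ ∧ osc r = u := by
  obtain ⟨n, hn⟩ := exists_nat_gt δ⁻¹
  have hpos : 0 ≤ Real.arcsin u := Real.arcsin_nonneg.2 u.2.1
  have hn0 : (0 : ℝ) < n := (inv_pos.2 hδ).trans hn
  have hpi := Real.pi_gt_three
  have hlt : δ⁻¹ < Real.arcsin u + n * (2 * Real.pi) := by nlinarith
  -- The sine of the inverse of this number is exactly `u`, and a large `n` makes the number small.
  refine ⟨(Real.arcsin u + n * (2 * Real.pi))⁻¹, inv_pos.2 ((inv_pos.2 hδ).trans hlt),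
    inv_lt_of_inv_lt₀ hδ hlt, Subtype.ext ?_⟩
  change |Real.sin (_)⁻¹⁻¹| = _
  rw [inv_inv, Real.sin_add_nat_mul_two_pi, Real.sin_arcsin (by linarith [u.2.1]) u.2.2,
    abs_of_nonneg u.2.1]

/-- Including the whole segment over `0` absorbs the only discontinuity of `osc`; this makes the
spaces of the spectrum closed in the cube. -/
lemma isClosed_oscGraph : IsClosed {p : ℝ × unitInterval | p.1 = 0 ∨ p.2 = osc p.1} := by
  rw [← isOpen_compl_iff, isOpen_iff_mem_nhds]
  rintro ⟨d, u⟩ hp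
  simp only [mem_compl_iff, mem_ofPred_eq, not_or] at hp
  have h1 : ∀ᶠ p : ℝ × unitInterval in 𝓝 (d, u), p.1 ≠ 0 :=
    continuous_fst.continuousAt.eventually_ne hp.1
  have h2 : ∀ᶠ p : ℝ × unitInterval in 𝓝 (d, u), p.2 ≠ osc p.1 :=
    ((continuous_snd.tendsto (d, u)).prodMk_nhds ((continuousAt_osc hp.1).tendsto.comp
      (continuous_fst.tendsto (d, u)))).eventually
      (isClosed_diagonal.isOpen_compl.eventually_mem (show (u, osc d) ∈ (diagonal _)ᶜ from hp.2))
  filter_upwards [h1, h2] with p hp1 hp2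
  simp [hp1, hp2]

/-! ### Distances depending on countably many coordinates -/

/-- A distance on a cube that depends exactly on the coordinates in `S`. -/
structure IsCoordDist {T : Type} (S : Set T)
    (ρ : (T → unitInterval) → (T → unitInterval) → ℝ) : Prop where
  continuous : ∀ y, Continuous fun x => ρ x y
  nonneg : ∀ x y, 0 ≤ ρ x y
  eq_zero_iff : ∀ x y, ρ x y = 0 ↔ ∀ r ∈ S, x r = y r
  congr : ∀ x x' y y', (∀ r ∈ S, x r = x' r) → (∀ r ∈ S, y r = y' r) → ρ x y = ρ x' y'
  tendsto : ∀ (z : ℕ → T → unitInterval) (y : T → unitInterval),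
    Filter.Tendsto (fun n => ρ (z n) y) Filter.atTop (𝓝 0) →
      ∀ r ∈ S, Filter.Tendsto (fun n => z n r) Filter.atTop (𝓝 (y r))

lemma exists_isCoordDist {T : Type} {S : Set T} (hS : S.Countable) : ∃ ρ, IsCoordDist S ρ := by
  have := hS.to_subtype
  let _ : MetricSpace (S → unitInterval) := metrizableSpaceMetric _
  have hc : Continuous (S.domRestrict : (T → unitInterval) → S → unitInterval) :=
    continuous_pi fun r => continuous_apply r.1
  refine ⟨fun x y => dist (S.domRestrict x) (S.domRestrict y), fun y => hc.dist continuous_const,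
    fun _ _ => dist_nonneg, fun x y => ?_, fun x x' y y' hx hy => ?_, fun z y h r hr => ?_⟩
  · rw [dist_eq_zero, Set.domRestrict_eq_domRestrict_iff]
    rfl
  · rw [Set.domRestrict_eq_domRestrict_iff.2 hx, Set.domRestrict_eq_domRestrict_iff.2 hy]
  · have h1 := tendsto_iff_dist_tendsto_zero.2 h
    exact (tendsto_pi_nhds.1 h1) ⟨r, hr⟩

/-! ### Coding a tree in a cube -/

section Coding

variable {T : Type} [PartialOrder T] [IsSetTree T]

/-- Well-founded recursion on height in fixed-point form. The arbitrary filler in `G` is invisible,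
since `F r` reads only nodes of smaller height. -/
lemma exists_eq_recursion {V : Type} [Nonempty V] (F : T → (T → V) → V)
    (hF : ∀ r x x', (∀ r', nodeHeight r' < nodeHeight r → x r' = x' r') → F r x = F r x') :
    ∃ x : T → V, ∀ r, x r = F r x := by
  have hwf : WellFounded (fun a b : T => nodeHeight a < nodeHeight b) :=
    InvImage.wf nodeHeight Ordinal.lt_wf
  let G : ∀ r : T, (∀ r', nodeHeight r' < nodeHeight r → V) → V := fun r IH =>
    F r fun r' => if h : nodeHeight r' < nodeHeight r then IH r' h else Classical.arbitrary V
  refine ⟨hwf.fix G, fun r => ?_⟩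
  rw [WellFounded.fix_eq]
  exact hF _ _ _ fun r' hr' => by simp [hr']

/-- The set of nodes of height less than `α`. -/
def lowerNodes (T : Type) [PartialOrder T] [IsSetTree T] (α : Ordinal) : Set T :=
  {r | nodeHeight r < α}

variable (T) in
/-- Points `ι s` of the cube indexed by a tree that encode the nodes: at a node `r < s` the
coordinate of `ι s` tells the immediate successor of `r` below `s`, and at the other nodes `r` of
smaller height it oscillates with the distance between `ι s` and `ι r`. -/
structure TreeCoding where
  ρ : T → (T → unitInterval) → (T → unitInterval) → ℝ
  isCoordDist : ∀ r, IsCoordDist (lowerNodes T (nodeHeight r)) (ρ r)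
  q : T → unitInterval
  q_injective : ∀ r c d, r ⋖ c → r ⋖ d → q c = q d → c = d
  q_dense : ∀ r, Dense (q '' {c | r ⋖ c})
  ι : T → T → unitInterval
  ι_of_le : ∀ s r, nodeHeight s ≤ nodeHeight r → ι s r = 0
  ι_of_covBy : ∀ s r c, r ⋖ c → c ≤ s → ι s r = q c
  ι_of_not_lt : ∀ s r, nodeHeight r < nodeHeight s → ¬ r < s → ι s r = osc (ρ r (ι s) (ι r))

lemma exists_denumerable_dense : ∃ E : Set unitInterval, E.Countable ∧ E.Infinite ∧ Dense E := by
  obtain ⟨E, hE, hd⟩ := exists_countable_dense unitInterval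
  refine ⟨E, hE, fun hf => ?_, hd⟩
  have h1 : E = Set.univ := by rw [← hf.isClosed.closure_eq, hd.closure_eq]
  have : Infinite unitInterval := (Set.Icc_infinite (zero_lt_one' ℝ)).to_subtype
  exact Set.infinite_univ (h1 ▸ hf)

lemma IsNormalSuslin.countable_children (h : IsNormalSuslin T) (t : T) : {s | t ⋖ s}.Countable :=
  (h.antichain _ (isAntichain_treeLevel (Order.succ (nodeHeight t)))).mono
    fun _ hs => nodeHeight_of_covBy hs

/-- The children of each node are in bijection with one countable dense set `E`. A node has at most
one immediate predecessor, so these bijections glue to a single `q`. -/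
lemma IsNormalSuslin.exists_labels (h : IsNormalSuslin T) :
    ∃ q : T → unitInterval, (∀ r c d, r ⋖ c → r ⋖ d → q c = q d → c = d) ∧
      ∀ r, Dense (q '' {c | r ⋖ c}) := by
  obtain ⟨E, hE, hEi, hEd⟩ := exists_denumerable_dense
  have hex : ∀ r : T, ∃ f : T → unitInterval,
      Set.InjOn f {c | r ⋖ c} ∧ f '' {c | r ⋖ c} = E := by
    intro r
    have := (h.children r).to_subtype
    have := (h.countable_children r).to_subtype
    have := hEi.to_subtype
    have := hE.to_subtype
    obtain ⟨e⟩ : Nonempty ({c | r ⋖ c} ≃ E) := nonempty_equiv_of_countable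
    classical
    let f : T → unitInterval := fun c => if hc : r ⋖ c then (e ⟨c, hc⟩).1 else 0
    have hf : ∀ c (hc : r ⋖ c), f c = (e ⟨c, hc⟩).1 := fun c hc => dif_pos hc
    refine ⟨f, fun c hc d hd hcd => ?_, Subset.antisymm ?_ fun x hx => ?_⟩
    · rw [hf c hc, hf d hd] at hcd
      exact congrArg Subtype.val (e.injective (Subtype.ext hcd))
    · rintro _ ⟨c, hc, rfl⟩
      rw [hf c hc]
      exact (e _).2
    · refine ⟨(e.symm ⟨x, hx⟩).1, (e.symm ⟨x, hx⟩).2, ?_⟩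
      rw [hf _ (e.symm ⟨x, hx⟩).2]
      simp
  choose f hfi hfE using hex
  classical
  let q : T → unitInterval := fun c => if hc : ∃ r, r ⋖ c then f hc.choose c else 0
  have hq : ∀ r c, r ⋖ c → q c = f r c := by
    intro r c hrc
    have hc : ∃ r, r ⋖ c := ⟨r, hrc⟩
    have : hc.choose = r := by
      refine eq_of_nodeHeight_eq hc.choose_spec.1.le hrc.1.le (Order.succ_injective ?_)
      rw [← nodeHeight_of_covBy hc.choose_spec, ← nodeHeight_of_covBy hrc]
    change dite _ _ _ = _
    rw [dif_pos hc, this]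
  refine ⟨q, fun r c d hc hd hcd => hfi r hc hd ?_, fun r => ?_⟩
  · rwa [hq r c hc, hq r d hd] at hcd
  · have : q '' {c | r ⋖ c} = E := (Set.image_congr fun c hc => hq r c hc).trans (hfE r)
    rw [this]
    exact hEd

/-- The recursion runs over the coordinate `r` and produces the function `s ↦ ι s r` for all `s` at
once, because the oscillating value of `ι s` at `r` also uses the lower coordinates of `ι r`. -/
lemma IsNormalSuslin.nonempty_treeCoding (h : IsNormalSuslin T) : Nonempty (TreeCoding T) := by
  have hρ : ∀ r : T, ∃ ρ, IsCoordDist (lowerNodes T (nodeHeight r)) ρ := fun r =>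
    exists_isCoordDist (countable_nodeHeight_lt h.antichain (nodeHeight_lt_omega_one h.chain r))
  choose ρ hρ using hρ
  obtain ⟨q, hq, hqd⟩ := h.exists_labels
  classical
  let F : T → (T → T → unitInterval) → T → unitInterval := fun r x s =>
    if nodeHeight s ≤ nodeHeight r then 0
    else if hc : ∃ c, r ⋖ c ∧ c ≤ s then q hc.choose
    else osc (ρ r (fun r' => x r' s) (fun r' => x r' r))
  obtain ⟨x, hx⟩ := exists_eq_recursion F fun r x x' hxx' => by
    funext s
    simp only [F]
    rw [(hρ r).congr (fun r' => x r' s) (fun r' => x' r' s) (fun r' => x r' r) (fun r' => x' r' r)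
      (fun r' hr' => congrFun (hxx' r' hr') s) (fun r' hr' => congrFun (hxx' r' hr') r)]
  refine ⟨⟨ρ, hρ, q, hq, hqd, fun s r => x r s, fun s r hsr => ?_, fun s r c hrc hcs => ?_,
    fun s r hrs hnot => ?_⟩⟩
  · rw [hx]
    exact if_pos hsr
  · have hc : ∃ c, r ⋖ c ∧ c ≤ s := ⟨c, hrc, hcs⟩
    rw [hx]
    simp only [F]
    rw [if_neg (not_le.2 ((nodeHeight_strictMono hrc.1).trans_le
      (nodeHeight_strictMono.monotone hcs))), dif_pos hc]
    congr 1
    refine eq_of_nodeHeight_eq hc.choose_spec.2 hcs ?_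
    rw [nodeHeight_of_covBy hrc, nodeHeight_of_covBy hc.choose_spec.1]
  · rw [hx]
    simp only [F]
    rw [if_neg (not_le.2 hrs), dif_neg]
    rintro ⟨c, hrc, hcs⟩
    exact hnot (hrc.1.trans_le hcs)

end Coding

/-! ### The spaces of the spectrum -/

section Spaces

variable {T : Type} [PartialOrder T] [IsSetTree T]

/-- Replace the coordinates at nodes of height at least `α` by zero. -/
noncomputable def trunc (α : Ordinal) (x : T → unitInterval) : T → unitInterval :=
  fun r => if nodeHeight r < α then x r else 0

lemma trunc_apply_of_lt {α : Ordinal} (x : T → unitInterval) {r : T} (h : nodeHeight r < α) :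
    trunc α x r = x r := if_pos h

lemma trunc_apply_of_le {α : Ordinal} (x : T → unitInterval) {r : T} (h : α ≤ nodeHeight r) :
    trunc α x r = 0 := if_neg (not_lt.2 h)

lemma trunc_eq_trunc_iff {α : Ordinal} {x y : T → unitInterval} :
    trunc α x = trunc α y ↔ ∀ r, nodeHeight r < α → x r = y r := by
  refine ⟨fun h r hr => ?_, fun h => funext fun r => ?_⟩
  · rw [← trunc_apply_of_lt x hr, h, trunc_apply_of_lt y hr]
  · by_cases hr : nodeHeight r < α
    · rw [trunc_apply_of_lt x hr, h r hr, trunc_apply_of_lt y hr]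
    · rw [trunc_apply_of_le x (not_lt.1 hr), trunc_apply_of_le y (not_lt.1 hr)]

lemma trunc_trunc {α β : Ordinal} (h : α ≤ β) (x : T → unitInterval) :
    trunc α (trunc β x) = trunc α x :=
  trunc_eq_trunc_iff.2 fun _ hr => trunc_apply_of_lt x (hr.trans_le h)

lemma trunc_eq_of_le {α β : Ordinal} (h : α ≤ β) {x y : T → unitInterval}
    (hxy : trunc β x = trunc β y) : trunc α x = trunc α y := by
  rw [← trunc_trunc h, hxy, trunc_trunc h]

lemma continuous_trunc (α : Ordinal) :
    Continuous (trunc α : (T → unitInterval) → T → unitInterval) := by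
  refine continuous_pi fun r => ?_
  by_cases hr : nodeHeight r < α
  · simpa only [trunc, if_pos hr] using continuous_apply r
  · simpa only [trunc, if_neg hr] using continuous_const

namespace TreeCoding

variable (D : TreeCoding T)

/-- The `β`-th space of the spectrum. -/
def space (β : Ordinal) : Set (T → unitInterval) :=
  {x | (∀ r, nodeHeight r < β → D.ρ r x (D.ι r) = 0 ∨ x r = osc (D.ρ r x (D.ι r))) ∧
    ∀ r, β ≤ nodeHeight r → x r = 0}

/-- The fibre over `y` of the projection from the `β`-th space to the `α`-th space. -/
def fib (α β : Ordinal) (y : T → unitInterval) : Set (T → unitInterval) :=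
  {x | x ∈ D.space β ∧ trunc α x = y}

variable {D}

lemma ρ_congr {r : T} {x x' : T → unitInterval}
    (h : ∀ r', nodeHeight r' < nodeHeight r → x r' = x' r') (y : T → unitInterval) :
    D.ρ r x y = D.ρ r x' y :=
  (D.isCoordDist r).congr _ _ _ _ h fun _ _ => rfl

lemma ρ_trunc {r : T} {α : Ordinal} (h : nodeHeight r ≤ α) (x y : T → unitInterval) :
    D.ρ r (trunc α x) y = D.ρ r x y :=
  ρ_congr (fun _ hr' => trunc_apply_of_lt x (hr'.trans_le h)) y

lemma ι_eq_ι_of_le {s t : T} (h : s ≤ t) :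
    ∀ r, nodeHeight r < nodeHeight s → D.ι t r = D.ι s r := by
  have hwf : WellFounded (fun a b : T => nodeHeight a < nodeHeight b) :=
    InvImage.wf nodeHeight Ordinal.lt_wf
  intro r
  induction r using hwf.induction with
  | _ r ih =>
    intro hr
    by_cases hrs : r < s
    · obtain ⟨c, hrc, hcs⟩ := exists_covBy_le hrs
      rw [D.ι_of_covBy s r c hrc hcs, D.ι_of_covBy t r c hrc (hcs.trans h)]
    · rw [D.ι_of_not_lt s r hr hrs, D.ι_of_not_lt t r
        (hr.trans_le (nodeHeight_strictMono.monotone h))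
        (fun hrt => hrs (lt_of_nodeHeight_lt hrt.le h hr))]
      rw [ρ_congr fun r' hr' => ih r' hr' (hr'.trans hr)]

lemma trunc_ι {s t : T} (h : s ≤ t) : trunc (nodeHeight s) (D.ι t) = D.ι s := by
  funext r
  by_cases hr : nodeHeight r < nodeHeight s
  · rw [trunc_apply_of_lt _ hr, ι_eq_ι_of_le h r hr]
  · rw [trunc_apply_of_le _ (not_lt.1 hr), D.ι_of_le s r (not_lt.1 hr)]

lemma ρ_eq_zero_iff {r : T} {x : T → unitInterval} :
    D.ρ r x (D.ι r) = 0 ↔ trunc (nodeHeight r) x = D.ι r := by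
  rw [(D.isCoordDist r).eq_zero_iff, ← trunc_ι (D := D) (le_refl r), trunc_eq_trunc_iff,
    trunc_ι le_rfl]
  rfl

lemma ι_mem_space (t : T) : D.ι t ∈ D.space (nodeHeight t) := by
  refine ⟨fun r hr => ?_, fun r hr => D.ι_of_le t r hr⟩
  by_cases hrt : r < t
  · exact Or.inl (ρ_eq_zero_iff.2 (trunc_ι hrt.le))
  · exact Or.inr (D.ι_of_not_lt t r hr hrt)

/-- At the branching node of `s` and `t` the two codes carry labels of different children. -/
lemma ι_injective (h : IsNormalSuslin T) {s t : T} (hst : nodeHeight s = nodeHeight t)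
    (he : D.ι s = D.ι t) : s = t := by
  by_contra hne
  obtain ⟨r, c, d, hrc, hrd, hcs, hdt, hcd⟩ := h.exists_branching hst hne
  refine hcd (D.q_injective r c d hrc hrd ?_)
  rw [← D.ι_of_covBy s r c hrc hcs, ← D.ι_of_covBy t r d hrd hdt, he]

lemma trunc_mem_space {α β : Ordinal} (h : α ≤ β) {x : T → unitInterval} (hx : x ∈ D.space β) :
    trunc α x ∈ D.space α := by
  refine ⟨fun r hr => ?_, fun r hr => trunc_apply_of_le x hr⟩
  rw [ρ_trunc hr.le, trunc_apply_of_lt x hr]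
  exact hx.1 r (hr.trans_le h)

lemma trunc_of_mem {α β : Ordinal} (h : α ≤ β) {x : T → unitInterval} (hx : x ∈ D.space α) :
    trunc β x = x := by
  funext r
  by_cases hr : nodeHeight r < β
  · exact trunc_apply_of_lt x hr
  · rw [trunc_apply_of_le x (not_lt.1 hr), hx.2 r (h.trans (not_lt.1 hr))]

lemma eq_osc {β : Ordinal} {x : T → unitInterval} (hx : x ∈ D.space β) {r : T}
    (hr : nodeHeight r < β) (hne : trunc (nodeHeight r) x ≠ D.ι r) :
    x r = osc (D.ρ r x (D.ι r)) :=
  (hx.1 r hr).resolve_left fun h => hne (ρ_eq_zero_iff.1 h)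

lemma isClosed_space (β : Ordinal) : IsClosed (D.space β) := by
  have : D.space β = (⋂ r, ⋂ (_ : nodeHeight r < β), (fun x : T → unitInterval =>
      (D.ρ r x (D.ι r), x r)) ⁻¹' {p | p.1 = 0 ∨ p.2 = osc p.1}) ∩
      ⋂ r, ⋂ (_ : β ≤ nodeHeight r), {x | x r = 0} := by
    ext x
    simp [space]
  rw [this]
  refine (isClosed_iInter fun r => isClosed_iInter fun _ => isClosed_oscGraph.preimage ?_).inter
    (isClosed_iInter fun r => isClosed_iInter fun _ =>
      isClosed_eq (continuous_apply r) continuous_const)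
  exact ((D.isCoordDist r).continuous _).prodMk (continuous_apply r)

lemma isCompact_space (β : Ordinal) : IsCompact (D.space β) := (isClosed_space β).isCompact

lemma isClosed_fib (α β : Ordinal) (y : T → unitInterval) : IsClosed (D.fib α β y) :=
  (isClosed_space β).inter (isClosed_eq (continuous_trunc α) continuous_const)

/-- Extend `y` by recursion on height: use `f` where the coordinate is free and the oscillation
where it is forced. -/
lemma exists_mem_space {α β : Ordinal} (h : α ≤ β) {y : T → unitInterval} (hy : y ∈ D.space α)
    (f : T → unitInterval) : ∃ x ∈ D.fib α β y, ∀ r, α ≤ nodeHeight r → nodeHeight r < β →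
      trunc (nodeHeight r) x = D.ι r → x r = f r := by
  classical
  let F : T → (T → unitInterval) → unitInterval := fun r x =>
    if nodeHeight r < α then y r else if nodeHeight r < β then
      if D.ρ r x (D.ι r) = 0 then f r else osc (D.ρ r x (D.ι r)) else 0
  obtain ⟨x, hx⟩ := exists_eq_recursion F fun r x x' hxx' => by
    simp only [F]
    rw [ρ_congr hxx']
  have hxy : trunc α x = y := by
    funext r
    by_cases hr : nodeHeight r < α
    · rw [trunc_apply_of_lt x hr, hx]
      exact if_pos hr
    · rw [trunc_apply_of_le x (not_lt.1 hr), hy.2 r (not_lt.1 hr)]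
  refine ⟨x, ⟨⟨fun r hr => ?_, fun r hr => ?_⟩, hxy⟩, fun r hr hr' hxr => ?_⟩
  · by_cases hrα : nodeHeight r < α
    · have := hy.1 r hrα
      rwa [← hxy, ρ_trunc hrα.le, trunc_apply_of_lt x hrα] at this
    · by_cases h0 : D.ρ r x (D.ι r) = 0
      · exact Or.inl h0
      · right
        conv_lhs => rw [hx]
        simp only [F]
        rw [if_neg hrα, if_pos hr, if_neg h0]
  · rw [hx]
    simp only [F]
    rw [if_neg (not_lt.2 (h.trans hr)), if_neg (not_lt.2 hr)]
  · rw [hx]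
    simp only [F]
    rw [if_neg (not_lt.2 hr), if_pos hr', if_pos (ρ_eq_zero_iff.2 hxr)]

lemma fib_nonempty {α β : Ordinal} (h : α ≤ β) {y : T → unitInterval} (hy : y ∈ D.space α) :
    (D.fib α β y).Nonempty := by
  obtain ⟨x, hx, -⟩ := exists_mem_space h hy fun _ => 0
  exact ⟨x, hx⟩

/-- Forced coordinates are functions of lower ones, so only the free coordinates can separate two
points of a fibre. -/
lemma eq_of_trunc_eq {α β : Ordinal} {x x' : T → unitInterval} (hx : x ∈ D.space β)
    (hx' : x' ∈ D.space β) (htr : trunc α x = trunc α x')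
    (h : ∀ r, α ≤ nodeHeight r → nodeHeight r < β → trunc (nodeHeight r) x = D.ι r → x r = x' r) :
    x = x' := by
  have hwf : WellFounded (fun a b : T => nodeHeight a < nodeHeight b) :=
    InvImage.wf nodeHeight Ordinal.lt_wf
  funext r
  induction r using hwf.induction with
  | _ r ih =>
    by_cases hrα : nodeHeight r < α
    · exact trunc_eq_trunc_iff.1 htr r hrα
    by_cases hrβ : nodeHeight r < β
    · by_cases hr : trunc (nodeHeight r) x = D.ι r
      · exact h r (not_lt.1 hrα) hrβ hr
      · have : trunc (nodeHeight r) x = trunc (nodeHeight r) x' := trunc_eq_trunc_iff.2 ih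
        rw [eq_osc hx hrβ hr, eq_osc hx' hrβ (this ▸ hr), ρ_congr ih]
    · rw [hx.2 r (not_lt.1 hrβ), hx'.2 r (not_lt.1 hrβ)]

end TreeCoding

end Spaces

/-! ### Connectedness of fibres -/

/-- Two closed pieces covering the preimage have closed images covering `Z`. These images meet, and
the connected fibre over a common point meets both pieces, hence their intersection. -/
lemma isConnected_inter_preimage {E F : Type*} [TopologicalSpace E] [TopologicalSpace F] [T2Space E]
    [T2Space F] {K : Set E} (hK : IsCompact K) {f : E → F} (hf : Continuous f) {Z : Set F}
    (hZ : IsConnected Z) (hfib : ∀ z ∈ Z, IsConnected (K ∩ f ⁻¹' {z})) :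
    IsConnected (K ∩ f ⁻¹' Z) := by
  constructor
  · obtain ⟨z, hz⟩ := hZ.nonempty
    obtain ⟨x, hx, hxz⟩ := (hfib z hz).nonempty
    have hxz' : f x = z := hxz
    exact ⟨x, hx, show f x ∈ Z by rwa [hxz']⟩
  · rw [isPreconnected_closed_iff]
    rintro t t' ht ht' hsub ⟨a, ⟨haK, haZ⟩, hat⟩ ⟨b, ⟨hbK, hbZ⟩, hbt⟩
    have hcl : ∀ t, IsClosed t → IsClosed (f '' (K ∩ t)) := fun t ht =>
      ((hK.inter_right ht).image hf).isClosed
    obtain ⟨z, hz, ⟨p, ⟨hpK, hpt⟩, hpz⟩, ⟨p', ⟨hpK', hpt'⟩, hpz'⟩⟩ :=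
      isPreconnected_closed_iff.1 hZ.isPreconnected _ _ (hcl t ht) (hcl t' ht')
        (fun z hz => by
          obtain ⟨x, hx, hxz⟩ := (hfib z hz).nonempty
          have hxz' : f x = z := hxz
          rcases hsub ⟨hx, show f x ∈ Z by rwa [hxz']⟩ with h1 | h1
          · exact Or.inl ⟨x, ⟨hx, h1⟩, hxz⟩
          · exact Or.inr ⟨x, ⟨hx, h1⟩, hxz⟩)
        ⟨f a, haZ, a, ⟨haK, hat⟩, rfl⟩ ⟨f b, hbZ, b, ⟨hbK, hbt⟩, rfl⟩
    have hss : K ∩ f ⁻¹' {z} ⊆ K ∩ f ⁻¹' Z := by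
      rintro x ⟨hx, hxz⟩
      have hxz' : f x = z := hxz
      exact ⟨hx, show f x ∈ Z by rwa [hxz']⟩
    obtain ⟨x, hx, hxt⟩ := isPreconnected_closed_iff.1 (hfib z hz).isPreconnected t t' ht ht'
      (hss.trans hsub) ⟨p, ⟨hpK, hpz⟩, hpt⟩ ⟨p', ⟨hpK', hpz'⟩, hpt'⟩
    exact ⟨x, hss hx, hxt⟩

section Fibres

variable {T : Type} [PartialOrder T] [IsSetTree T] {D : TreeCoding T}

namespace TreeCoding

/-- A free coordinate `r` above height `α` would make `y` the code of the predecessor of `r` at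
height `α`; so every coordinate is forced. -/
lemma fib_eq_singleton {α β : Ordinal} {x y : T → unitInterval}
    (hy : ∀ s, nodeHeight s = α → D.ι s ≠ y) (hx : x ∈ D.fib α β y) : D.fib α β y = {x} := by
  refine Subset.antisymm (fun x' hx' => ?_) (singleton_subset_iff.2 hx)
  refine (eq_of_trunc_eq hx.1 hx'.1 (hx.2.trans hx'.2.symm) fun r hr _ hxr => ?_).symm
  obtain ⟨s, hsr, hs⟩ := exists_le_of_le_nodeHeight hr
  refine absurd ?_ (hy s hs)
  rw [← trunc_ι hsr, ← hxr, hs, trunc_trunc hr, hx.2]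

-- By injectivity of the codes on a level, `s` is the only free coordinate in this fibre, and the
-- other coordinates on its level do not read it.
open scoped Classical in
lemma fib_succ_eq_range (h : IsNormalSuslin T) {s : T} {x : T → unitInterval}
    (hx : x ∈ D.fib (nodeHeight s) (Order.succ (nodeHeight s)) (D.ι s)) :
    D.fib (nodeHeight s) (Order.succ (nodeHeight s)) (D.ι s) =
      Set.range fun u => Function.update x s u := by
  have hupd : ∀ (u : unitInterval) (r : T), nodeHeight r ≤ nodeHeight s →
      ∀ r', nodeHeight r' < nodeHeight r → Function.update x s u r' = x r' := by
    intro u r hr r' hr'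
    refine Function.update_of_ne (fun e => ?_) _ _
    rw [e] at hr'
    exact absurd hr (not_le.2 hr')
  have hmem : ∀ u, Function.update x s u ∈
      D.fib (nodeHeight s) (Order.succ (nodeHeight s)) (D.ι s) := by
    refine fun u => ⟨⟨fun r hr => ?_, fun r hr => ?_⟩, ?_⟩
    · have hr' := Order.lt_succ_iff.1 hr
      rw [ρ_congr (hupd u r hr')]
      by_cases hrs : r = s
      · exact Or.inl (hrs ▸ ρ_eq_zero_iff.2 hx.2)
      · rw [Function.update_of_ne hrs]
        exact hx.1.1 r hr
    · rw [Function.update_of_ne (fun e => ?_)]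
      · exact hx.1.2 r hr
      · rw [e] at hr
        exact absurd (Order.lt_succ _) (not_lt.2 hr)
    · rw [← hx.2]
      exact trunc_eq_trunc_iff.2 (hupd u s le_rfl)
  refine Subset.antisymm (fun x' hx' => ⟨x' s, ?_⟩) ?_
  · refine (eq_of_trunc_eq hx'.1 (hmem _).1 (hx'.2.trans (hmem _).2.symm) fun r hr hr' hxr => ?_).symm
    have hrs : nodeHeight r = nodeHeight s := le_antisymm (Order.lt_succ_iff.1 hr') hr
    have : r = s := ι_injective h hrs (by rw [← hxr, hrs, hx'.2])
    simp [this]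
  · rintro _ ⟨u, rfl⟩
    exact hmem u

lemma isConnected_fib_succ (h : IsNormalSuslin T) {γ : Ordinal} {y : T → unitInterval}
    (hy : y ∈ D.space γ) : IsConnected (D.fib γ (Order.succ γ) y) := by
  obtain ⟨x, hx⟩ := fib_nonempty (Order.le_succ γ) hy
  by_cases hs : ∃ s, nodeHeight s = γ ∧ D.ι s = y
  · classical
    obtain ⟨s, rfl, rfl⟩ := hs
    rw [fib_succ_eq_range h hx]
    exact isConnected_range (continuous_const.update s continuous_id)
  · push Not at hs
    rw [fib_eq_singleton hs hx]
    exact isConnected_singleton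

lemma fib_eq_inter_preimage {α γ β : Ordinal} (hαγ : α ≤ γ) (hγβ : γ ≤ β) (y : T → unitInterval) :
    D.fib α β y = D.space β ∩ trunc γ ⁻¹' D.fib α γ y := by
  ext x
  refine ⟨fun hx => ⟨hx.1, trunc_mem_space hγβ hx.1, ?_⟩, fun hx => ⟨hx.1, ?_⟩⟩
  · rw [trunc_trunc hαγ, hx.2]
  · rw [← trunc_trunc hαγ]
    exact hx.2.2

lemma isConnected_fib (h : IsNormalSuslin T) {α β : Ordinal} (hαβ : α ≤ β) {y : T → unitInterval}
    (hy : y ∈ D.space α) : IsConnected (D.fib α β y) := by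
  induction β using Ordinal.lt_wf.induction with
  | _ β ih =>
  rcases hαβ.eq_or_lt with rfl | hlt
  · have : D.fib α α y = {y} := by
      refine Subset.antisymm (fun x hx => ?_) (singleton_subset_iff.2 ⟨hy, trunc_of_mem le_rfl hy⟩)
      exact (trunc_of_mem le_rfl hx.1).symm.trans hx.2
    rw [this]
    exact isConnected_singleton
  rcases Ordinal.zero_or_succ_or_isSuccLimit β with rfl | ⟨γ, rfl⟩ | hlim
  · exact absurd hlt (not_lt.2 zero_le)
  · have hαγ : α ≤ γ := Order.lt_succ_iff.1 hlt
    rw [fib_eq_inter_preimage hαγ (Order.le_succ γ)]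
    exact isConnected_inter_preimage (isCompact_space _) (continuous_trunc γ)
      (ih γ (Order.lt_succ γ) hαγ) fun z hz => isConnected_fib_succ h hz.1
  · refine ⟨fib_nonempty hαβ hy, ?_⟩
    rw [isPreconnected_closed_iff]
    intro t t' ht ht' hsub hnt hnt'
    have hcomp : ∀ t, IsClosed t → IsCompact (D.fib α β y ∩ t) := fun t ht =>
      (isClosed_fib α β y).isCompact.inter_right ht
    -- At a limit, consider pairs from the two closed pieces that agree below `γ`. They exist by
    -- connectedness of the fibre at stage `γ`, and compactness gives a pair agreeing below every `γ
    -- < β`, that is, a common point.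
    let C : Set.Ico α β → Set ((T → unitInterval) × (T → unitInterval)) := fun γ =>
      ((D.fib α β y ∩ t) ×ˢ (D.fib α β y ∩ t')) ∩ {p | trunc γ.1 p.1 = trunc γ.1 p.2}
    have hclC : ∀ γ, IsClosed {p : (T → unitInterval) × (T → unitInterval) |
        trunc (γ : Set.Ico α β).1 p.1 = trunc γ.1 p.2} := fun γ =>
      isClosed_eq ((continuous_trunc _).comp continuous_fst) ((continuous_trunc _).comp continuous_snd)
    have hC : ∀ γ, IsCompact (C γ) := fun γ =>
      ((hcomp t ht).prod (hcomp t' ht')).inter_right (hclC γ)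
    have hne : ∀ γ, (C γ).Nonempty := by
      rintro ⟨γ, hαγ, hγβ⟩
      have hmap : ∀ x ∈ D.fib α β y, trunc γ x ∈ D.fib α γ y := fun x hx => by
        rw [fib_eq_inter_preimage hαγ hγβ.le] at hx
        exact hx.2
      have hcl : ∀ t, IsClosed t → IsClosed (trunc γ '' (D.fib α β y ∩ t)) := fun t ht =>
        ((hcomp t ht).image (continuous_trunc γ)).isClosed
      obtain ⟨a, hay, hat⟩ := hnt
      obtain ⟨b, hby, hbt⟩ := hnt'
      obtain ⟨z, hz, ⟨p, hp, hpz⟩, ⟨p', hp', hpz'⟩⟩ :=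
        isPreconnected_closed_iff.1 (ih γ hγβ hαγ).isPreconnected _ _ (hcl t ht) (hcl t' ht')
          (fun z hz => by
            obtain ⟨x, hx⟩ := fib_nonempty hγβ.le hz.1
            have hx' : x ∈ D.fib α β y := by
              rw [fib_eq_inter_preimage hαγ hγβ.le]
              exact ⟨hx.1, show trunc γ x ∈ _ by rwa [hx.2]⟩
            rcases hsub hx' with h1 | h1
            · exact Or.inl ⟨x, ⟨hx', h1⟩, hx.2⟩
            · exact Or.inr ⟨x, ⟨hx', h1⟩, hx.2⟩)
          ⟨_, hmap a hay, a, ⟨hay, hat⟩, rfl⟩ ⟨_, hmap b hby, b, ⟨hby, hbt⟩, rfl⟩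
      exact ⟨(p, p'), ⟨hp, hp'⟩, hpz.trans hpz'.symm⟩
    have hdir : Directed (· ⊇ ·) C := by
      intro γ δ
      rcases le_total γ δ with hle | hle
      · exact ⟨δ, fun p hp => ⟨hp.1, trunc_eq_of_le hle hp.2⟩, Subset.rfl⟩
      · exact ⟨γ, Subset.rfl, fun p hp => ⟨hp.1, trunc_eq_of_le hle hp.2⟩⟩
    have : Nonempty (Set.Ico α β) := ⟨⟨α, le_rfl, hlt⟩⟩
    obtain ⟨⟨a, b⟩, hab⟩ := IsCompact.nonempty_iInter_of_directed_nonempty_isCompact_isClosed C hdir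
      hne hC fun γ => (hC γ).isClosed
    rw [mem_iInter] at hab
    obtain ⟨⟨ha, hb⟩, -⟩ := hab ⟨α, le_rfl, hlt⟩
    have hab' : a = b := by
      funext r
      by_cases hr : nodeHeight r < β
      · exact trunc_eq_trunc_iff.1 (hab ⟨max α (Order.succ (nodeHeight r)), le_max_left _ _,
          max_lt hlt (hlim.succ_lt hr)⟩).2 r (lt_max_of_lt_right (Order.lt_succ _))
      · exact (ha.1.1.2 r (not_lt.1 hr)).trans (hb.1.1.2 r (not_lt.1 hr)).symm
    exact ⟨a, ha.1, ha.2, hab' ▸ hb.2⟩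

lemma isConnected_inter_preimage_trunc (h : IsNormalSuslin T) {α β : Ordinal} (hαβ : α ≤ β)
    {Z : Set (T → unitInterval)} (hZ : IsConnected Z) (hZα : Z ⊆ D.space α) :
    IsConnected (D.space β ∩ trunc α ⁻¹' Z) :=
  isConnected_inter_preimage (isCompact_space β) (continuous_trunc α) hZ
    fun _ hz => isConnected_fib h hαβ (hZα hz)

end TreeCoding

end Fibres

/-! ### Irreducibility of the projections -/

/-- Hit `u` exactly, then perturb the distance off `N` by continuity. -/
lemma exists_osc_near {N : Set ℝ} (hN : N.Countable) (u : unitInterval) {δ ε : ℝ} (hδ : 0 < δ)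
    (hε : 0 < ε) : ∃ r, 0 < r ∧ r < δ ∧ r ∉ N ∧ dist (osc r) u < ε := by
  obtain ⟨r, hr0, hrδ, hru⟩ := exists_osc_eq u hδ
  have h1 : ∀ᶠ x in 𝓝 r, dist (osc x) u < ε := by
    have := (continuousAt_osc hr0.ne').tendsto
    rw [hru] at this
    exact this.eventually (Metric.ball_mem_nhds u hε)
  obtain ⟨V, hV, hVo, hrV⟩ := eventually_nhds_iff.1
    ((h1.and (eventually_gt_nhds hr0)).and (eventually_lt_nhds hrδ))
  obtain ⟨x, hxV, hxN⟩ := (hN.dense_compl ℝ).inter_open_nonempty V hVo ⟨r, hrV⟩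
  exact ⟨x, (hV x hxV).1.2, (hV x hxV).2, hxN, (hV x hxV).1.1⟩

section Irreducible

variable {T : Type} [PartialOrder T] [IsSetTree T] {D : TreeCoding T}

namespace TreeCoding

/-- The sine curve argument. If `x` lies on the arc over `ι s`, the distance to `ι s` takes all
small values on `Z`, so there are `z n ∈ Z` tending to `ι s` whose oscillation at `s` tends to `x
s`. Their lifts tend to `x`. -/
lemma exists_fib_succ_subset (h : IsNormalSuslin T) {γ : Ordinal} {Z O : Set (T → unitInterval)}
    (hZγ : Z ⊆ D.space γ) (hZ : IsConnected Z) (hZn : Z.Nontrivial) (hO : IsOpen O)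
    {x : T → unitInterval} (hx : x ∈ D.space (Order.succ γ)) (hxO : x ∈ O) (hxZ : trunc γ x ∈ Z) :
    ∃ z ∈ Z, D.fib γ (Order.succ γ) z ⊆ O := by
  by_cases hs : ∃ s, nodeHeight s = γ ∧ D.ι s = trunc γ x
  swap
  · push Not at hs
    refine ⟨_, hxZ, ?_⟩
    rw [fib_eq_singleton hs ⟨hx, rfl⟩]
    exact singleton_subset_iff.2 hxO
  obtain ⟨s, rfl, hsx⟩ := hs
  rw [← hsx] at hxZ
  obtain ⟨z₁, hz₁, hz₁s⟩ := hZn.exists_ne (D.ι s)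
  have hpos : 0 < D.ρ s z₁ (D.ι s) := by
    refine lt_of_le_of_ne ((D.isCoordDist s).nonneg _ _) fun e => hz₁s ?_
    rw [← ρ_eq_zero_iff.1 e.symm, trunc_of_mem le_rfl (hZγ hz₁)]
  -- Avoiding the distances of the coded points keeps the `z n` uncoded, so each of their fibres is
  -- a single point.
  have hN : ((fun t => D.ρ s (D.ι t) (D.ι s)) '' treeLevel T (nodeHeight s)).Countable :=
    (h.antichain _ (isAntichain_treeLevel _)).image _
  have hex : ∀ n : ℕ, ∃ z ∈ Z, D.ρ s z (D.ι s) < 1 / ((n : ℝ) + 1) ∧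
      D.ρ s z (D.ι s) ≠ 0 ∧ (∀ t, nodeHeight t = nodeHeight s → D.ι t ≠ z) ∧
      dist (osc (D.ρ s z (D.ι s))) (x s) < 1 / ((n : ℝ) + 1) := by
    intro n
    obtain ⟨r, hr0, hrδ, hrN, hru⟩ := exists_osc_near hN (x s)
      (lt_min hpos (Nat.one_div_pos_of_nat (α := ℝ) (n := n))) (Nat.one_div_pos_of_nat (α := ℝ) (n := n))
    obtain ⟨z, hz, hzr⟩ := hZ.isPreconnected.intermediate_value hxZ hz₁
      ((D.isCoordDist s).continuous (D.ι s)).continuousOn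
      (show r ∈ Set.Icc _ _ by
        rw [ρ_eq_zero_iff.2 (trunc_ι le_rfl)]
        exact ⟨hr0.le, (hrδ.trans_le (min_le_left _ _)).le⟩)
    have hzr' : D.ρ s z (D.ι s) = r := hzr
    refine ⟨z, hz, ?_, ?_, fun t ht he => hrN ⟨t, ht, ?_⟩, ?_⟩
    · rw [hzr']; exact hrδ.trans_le (min_le_right _ _)
    · rw [hzr']; exact hr0.ne'
    · simp only
      rw [he, hzr']
    · rw [hzr']; exact hru
  choose z hzZ hzlt hz0 hzι hzosc using hex
  have hlim0 : Filter.Tendsto (fun n => D.ρ s (z n) (D.ι s)) Filter.atTop (𝓝 0) :=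
    squeeze_zero (fun n => (D.isCoordDist s).nonneg _ _) (fun n => (hzlt n).le)
      tendsto_one_div_add_atTop_nhds_zero_nat
  have hzlim : Filter.Tendsto z Filter.atTop (𝓝 (D.ι s)) := by
    refine tendsto_pi_nhds.2 fun r => ?_
    by_cases hr : nodeHeight r < nodeHeight s
    · exact (D.isCoordDist s).tendsto z _ hlim0 r hr
    · have : ∀ n, z n r = D.ι s r := fun n => by
        rw [(hZγ (hzZ n)).2 r (not_lt.1 hr), D.ι_of_le s r (not_lt.1 hr)]
      simp only [this]
      exact tendsto_const_nhds
  have hw : ∀ n, ∃ w, w ∈ D.fib (nodeHeight s) (Order.succ (nodeHeight s)) (z n) := fun n =>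
    fib_nonempty (Order.le_succ _) (hZγ (hzZ n))
  choose w hw using hw
  have hwlim : Filter.Tendsto w Filter.atTop (𝓝 x) := by
    refine tendsto_pi_nhds.2 fun r => ?_
    rcases lt_trichotomy (nodeHeight r) (nodeHeight s) with hr | hr | hr
    · have h1 : ∀ n, w n r = z n r := fun n => by rw [← (hw n).2, trunc_apply_of_lt _ hr]
      have h2 : D.ι s r = x r := by rw [hsx, trunc_apply_of_lt _ hr]
      simp only [h1]
      rw [← h2]
      exact tendsto_pi_nhds.1 hzlim r
    · have h1 : ∀ n, w n r = osc (D.ρ r (z n) (D.ι r)) := fun n => by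
        rw [eq_osc (hw n).1 (hr ▸ Order.lt_succ _), ← (hw n).2, ρ_trunc hr.le]
        rw [hr, (hw n).2]
        exact (hzι n r hr).symm
      simp only [h1]
      by_cases hrs : r = s
      · subst hrs
        rw [tendsto_iff_dist_tendsto_zero]
        exact squeeze_zero (fun n => dist_nonneg) (fun n => (hzosc n).le)
          tendsto_one_div_add_atTop_nhds_zero_nat
      -- At another node of the same level the limit distance is positive, and `osc` is continuous
      -- there.
      · have hne : trunc (nodeHeight r) x ≠ D.ι r := by
          rw [hr, ← hsx]
          exact fun e => hrs (ι_injective h hr e.symm)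
        have hx' : x r = osc (D.ρ r (D.ι s) (D.ι r)) := by
          rw [eq_osc hx (hr ▸ Order.lt_succ _) hne, hsx, ρ_trunc hr.le]
        rw [hx']
        refine (continuousAt_osc ?_).tendsto.comp
          ((((D.isCoordDist r).continuous (D.ι r)).tendsto _).comp hzlim)
        intro e
        rw [ρ_eq_zero_iff, hr, trunc_ι le_rfl] at e
        exact hrs (ι_injective h hr e.symm)
    · have h1 : ∀ n, w n r = x r := fun n => by
        rw [(hw n).1.2 r (Order.succ_le_of_lt hr), hx.2 r (Order.succ_le_of_lt hr)]
      simp only [h1]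
      exact tendsto_const_nhds
  obtain ⟨n, hn⟩ := (hwlim.eventually (hO.mem_nhds hxO)).exists
  refine ⟨z n, hzZ n, ?_⟩
  rw [fib_eq_singleton (hzι n) (hw n)]
  exact singleton_subset_iff.2 hn

/-- Truncation is a closed map on the compact space, so fibres vary upper semicontinuously. -/
lemma isOpen_fib_subset (α β : Ordinal) {O : Set (T → unitInterval)} (hO : IsOpen O) :
    IsOpen {w | D.fib α β w ⊆ O} := by
  have : {w | D.fib α β w ⊆ O} = (trunc α '' (D.space β ∩ Oᶜ))ᶜ := by
    ext w
    constructor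
    · rintro hw ⟨x, ⟨hx, hxO⟩, rfl⟩
      exact hxO (hw ⟨hx, rfl⟩)
    · intro hw x hx
      by_contra hxO
      exact hw ⟨x, ⟨hx.1, hxO⟩, hx.2⟩
  rw [this]
  exact (((isCompact_space β).inter_right hO.isClosed_compl).image
    (continuous_trunc α)).isClosed.isOpen_compl

theorem exists_fib_subset (h : IsNormalSuslin T) {α β : Ordinal} (hαβ : α ≤ β)
    {Z O : Set (T → unitInterval)} (hZα : Z ⊆ D.space α) (hZ : IsConnected Z) (hZn : Z.Nontrivial)
    (hO : IsOpen O) {x : T → unitInterval} (hx : x ∈ D.space β) (hxO : x ∈ O)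
    (hxZ : trunc α x ∈ Z) : ∃ z ∈ Z, D.fib α β z ⊆ O := by
  induction β using Ordinal.lt_wf.induction generalizing x O with
  | _ β ih =>
  rcases hαβ.eq_or_lt with rfl | hlt
  · refine ⟨_, hxZ, fun w hw => ?_⟩
    have h1 : w = x := by
      rw [← trunc_of_mem le_rfl hw.1, hw.2, trunc_of_mem le_rfl hx]
    rwa [h1]
  rcases Ordinal.zero_or_succ_or_isSuccLimit β with rfl | ⟨γ, rfl⟩ | hlim
  · exact absurd hlt (not_lt.2 zero_le)
  · have hαγ : α ≤ γ := Order.lt_succ_iff.1 hlt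
    have hZn' : (D.space γ ∩ trunc α ⁻¹' Z).Nontrivial := by
      obtain ⟨a, ha, b, hb, hab⟩ := hZn
      obtain ⟨a', ha'⟩ := fib_nonempty hαγ (hZα ha)
      obtain ⟨b', hb'⟩ := fib_nonempty hαγ (hZα hb)
      refine ⟨a', ⟨ha'.1, show trunc α a' ∈ Z by rwa [ha'.2]⟩, b',
        ⟨hb'.1, show trunc α b' ∈ Z by rwa [hb'.2]⟩, fun e => hab ?_⟩
      rw [← ha'.2, ← hb'.2, e]
    -- The one-step lemma is applied to the preimage of `Z` in stage `γ`, which is connected.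
    -- Induction then handles the open set of points whose fibre lies in `O`.
    obtain ⟨z', hz', hfib⟩ := exists_fib_succ_subset h inter_subset_left
      (isConnected_inter_preimage_trunc h hαγ hZ hZα) hZn' hO hx hxO
      ⟨trunc_mem_space (Order.le_succ γ) hx, show trunc α (trunc γ x) ∈ Z by rwa [trunc_trunc hαγ]⟩
    obtain ⟨z, hz, hzO⟩ := ih γ (Order.lt_succ γ) hαγ (isOpen_fib_subset γ (Order.succ γ) hO) hz'.1
      hfib hz'.2
    refine ⟨z, hz, fun w hw => ?_⟩
    rw [fib_eq_inter_preimage hαγ (Order.le_succ γ)] at hw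
    exact hzO hw.2 ⟨hw.1, rfl⟩
  -- A basic neighbourhood restricts finitely many coordinates. Those of height below `β` are seen
  -- at some stage `γ < β`, and the others vanish on the whole space.
  · obtain ⟨F, U, hU, hUO⟩ := isOpen_pi_iff.1 hO x hxO
    classical
    let F' := F.filter fun r => nodeHeight r < β
    let γ := max α (F'.sup fun r => Order.succ (nodeHeight r))
    have hγβ : γ < β := by
      refine max_lt hlt ((Finset.sup_lt_iff (lt_of_le_of_lt zero_le hlt)).2 fun r hr => ?_)
      exact hlim.succ_lt (Finset.mem_filter.1 hr).2
    have hF'γ : ∀ r ∈ F', nodeHeight r < γ := fun r hr =>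
      (Order.lt_succ (nodeHeight r)).trans_le
        ((Finset.le_sup (f := fun r => Order.succ (nodeHeight r)) hr).trans (le_max_right _ _))
    have hO' : IsOpen ((F' : Set T).pi U) :=
      isOpen_set_pi F'.finite_toSet fun r hr => (hU r (Finset.mem_filter.1 hr).1).1
    obtain ⟨z, hz, hzO⟩ := ih γ hγβ (le_max_left _ _) hO' (trunc_mem_space hγβ.le hx)
      (fun r hr => by
        rw [trunc_apply_of_lt x (hF'γ r hr)]
        exact (hU r (Finset.mem_filter.1 hr).1).2)
      (by rwa [trunc_trunc (le_max_left _ _)])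
    refine ⟨z, hz, fun w hw => hUO fun r hr => ?_⟩
    have hw' := hw
    rw [fib_eq_inter_preimage (le_max_left _ _ : α ≤ γ) hγβ.le] at hw'
    by_cases hrβ : nodeHeight r < β
    · have hr' : r ∈ F' := Finset.mem_filter.2 ⟨hr, hrβ⟩
      have := hzO hw'.2 r hr'
      rwa [trunc_apply_of_lt w (hF'γ r hr')] at this
    · rw [hw.1.2 r (not_lt.1 hrβ), ← hx.2 r (not_lt.1 hrβ)]
      exact (hU r hr).2

end TreeCoding

end Irreducible

/-! ### Subcontinua and nodes -/

section Subcontinua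

variable {T : Type} [PartialOrder T] [IsSetTree T] {D : TreeCoding T}

namespace TreeCoding

lemma eq_of_mem_fib_succ (h : IsNormalSuslin T) {s : T} {x x' : T → unitInterval}
    (hx : x ∈ D.fib (nodeHeight s) (Order.succ (nodeHeight s)) (D.ι s))
    (hx' : x' ∈ D.fib (nodeHeight s) (Order.succ (nodeHeight s)) (D.ι s)) (hs : x s = x' s) :
    x = x' := by
  refine eq_of_trunc_eq hx.1 hx'.1 (hx.2.trans hx'.2.symm) fun r hr hr' hxr => ?_
  have hrs : nodeHeight r = nodeHeight s := le_antisymm (Order.lt_succ_iff.1 hr') hr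
  have : r = s := ι_injective h hrs (by rw [← hxr, hrs, hx.2])
  rw [this, hs]

lemma ι_mem_fib_succ {s c : T} (hc : s ⋖ c) :
    D.ι c ∈ D.fib (nodeHeight s) (Order.succ (nodeHeight s)) (D.ι s) := by
  rw [← nodeHeight_of_covBy hc]
  exact ⟨ι_mem_space c, trunc_ι hc.1.le⟩

lemma fib_succ_subset_closure (h : IsNormalSuslin T) (s : T) :
    D.fib (nodeHeight s) (Order.succ (nodeHeight s)) (D.ι s) ⊆ closure (D.ι '' {c | s ⋖ c}) := by
  classical
  intro x hx
  have hcont : Continuous fun u : unitInterval => Function.update x s u :=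
    continuous_const.update s continuous_id
  have hsub : (fun u : unitInterval => Function.update x s u) '' (D.q '' {c | s ⋖ c}) ⊆
      D.ι '' {c | s ⋖ c} := by
    rintro _ ⟨_, ⟨c, hc, rfl⟩, rfl⟩
    have hmem : Function.update x s (D.q c) ∈
        D.fib (nodeHeight s) (Order.succ (nodeHeight s)) (D.ι s) := by
      rw [fib_succ_eq_range h hx]
      exact ⟨_, rfl⟩
    refine ⟨c, hc, eq_of_mem_fib_succ h (ι_mem_fib_succ hc) hmem ?_⟩
    exact (D.ι_of_covBy c s c hc le_rfl).trans (Function.update_self s (D.q c) x).symm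
  have hx' : x = Function.update x s (x s) := (Function.update_eq_self s x).symm
  rw [hx']
  exact closure_mono hsub (image_closure_subset_closure_image hcont
    ⟨x s, D.q_dense s (x s), rfl⟩)

/-- Atomicity makes a subcontinuum with nondegenerate image saturated: if `x` were outside `C`, a
whole fibre over a point of the image would avoid `C`. -/
lemma mem_of_trunc_mem_image (h : IsNormalSuslin T) {α β : Ordinal} (hαβ : α ≤ β)
    {C : Set (T → unitInterval)} (hCβ : C ⊆ D.space β) (hC : IsConnected C) (hCc : IsClosed C)
    (hn : (trunc α '' C).Nontrivial) {x : T → unitInterval} (hx : x ∈ D.space β)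
    (hxC : trunc α x ∈ trunc α '' C) : x ∈ C := by
  by_contra hxn
  obtain ⟨_, ⟨c, hc, rfl⟩, hcO⟩ := exists_fib_subset h hαβ
    (by rintro _ ⟨c, hc, rfl⟩; exact trunc_mem_space hαβ (hCβ hc))
    (hC.image _ (continuous_trunc α).continuousOn) hn hCc.isOpen_compl hx hxn hxC
  exact hcO ⟨hCβ hc, rfl⟩ hc

lemma exists_node_mem_image (h : IsNormalSuslin T) {β : Ordinal} {C : Set (T → unitInterval)}
    (hCβ : C ⊆ D.space β) (hC : IsConnected C) (hn : C.Nontrivial) :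
    ∃ t, nodeHeight t ≤ β ∧ (trunc (nodeHeight t) '' C).Nontrivial ∧
      D.ι t ∈ trunc (nodeHeight t) '' C := by
  have hwf : WellFounded (fun a b : T => nodeHeight a < nodeHeight b) :=
    InvImage.wf nodeHeight Ordinal.lt_wf
  obtain ⟨x₀, hx₀, y₀, hy₀, hxy₀⟩ := hn
  obtain ⟨r₀, hr₀⟩ := Function.ne_iff.1 hxy₀
  -- At a coordinate `s` of least height where `C` varies, the value must be free, so `C` projects
  -- into the arc over `ι s`. By the intermediate value theorem it attains the label of a child of
  -- `s`.
  obtain ⟨s, ⟨x, hx, y, hy, hxy⟩, hmin⟩ := hwf.has_min {r | ∃ x ∈ C, ∃ y ∈ C, x r ≠ y r}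
    ⟨r₀, x₀, hx₀, y₀, hy₀, hr₀⟩
  have hconst : ∀ x ∈ C, ∀ y ∈ C, ∀ r, nodeHeight r < nodeHeight s → x r = y r := by
    intro x hx y hy r hr
    by_contra hne
    exact hmin r ⟨x, hx, y, hy, hne⟩ hr
  have hsβ : nodeHeight s < β := by
    by_contra hs
    exact hxy ((hCβ hx).2 s (not_lt.1 hs) |>.trans ((hCβ hy).2 s (not_lt.1 hs)).symm)
  have hxs : trunc (nodeHeight s) x = D.ι s := by
    by_contra hne
    have htr : trunc (nodeHeight s) x = trunc (nodeHeight s) y :=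
      trunc_eq_trunc_iff.2 (hconst x hx y hy)
    refine hxy ?_
    rw [eq_osc (hCβ hx) hsβ hne, eq_osc (hCβ hy) hsβ (htr ▸ hne), ρ_congr (hconst x hx y hy)]
  obtain ⟨w, hw, c, hc, hwc⟩ : ∃ w ∈ C, ∃ c, s ⋖ c ∧ w s = D.q c := by
    have key : ∀ a ∈ C, ∀ b ∈ C, a s < b s → ∃ w ∈ C, ∃ c, s ⋖ c ∧ w s = D.q c := by
      intro a ha b hb hab
      obtain ⟨_, hv, ⟨c, hc, rfl⟩⟩ := (D.q_dense s).inter_open_nonempty _ isOpen_Ioo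
        (Set.nonempty_Ioo.2 hab)
      obtain ⟨w, hw, hwc⟩ := hC.isPreconnected.intermediate_value ha hb
        (continuous_apply s).continuousOn (Set.Ioo_subset_Icc_self hv)
      exact ⟨w, hw, c, hc, hwc⟩
    rcases lt_or_gt_of_ne hxy with hlt | hlt
    · exact key x hx y hy hlt
    · exact key y hy x hx hlt
  have hht := nodeHeight_of_covBy hc
  refine ⟨c, hht ▸ Order.succ_le_of_lt hsβ, ⟨_, ⟨x, hx, rfl⟩, _, ⟨y, hy, rfl⟩, fun e => hxy ?_⟩,
    w, hw, ?_⟩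
  · exact trunc_eq_trunc_iff.1 e s (nodeHeight_strictMono hc.1)
  · have hws : trunc (nodeHeight s) w = D.ι s := by
      rw [← hxs]
      exact trunc_eq_trunc_iff.2 (hconst w hw x hx)
    rw [hht]
    refine eq_of_mem_fib_succ h ⟨trunc_mem_space (Order.succ_le_of_lt hsβ) (hCβ hw), ?_⟩
      (ι_mem_fib_succ hc) ?_
    · rw [trunc_trunc (Order.le_succ _), hws]
    · rw [trunc_apply_of_lt _ (Order.lt_succ _), hwc, D.ι_of_covBy c s c hc le_rfl]

lemma fib_subset_fib {s t : T} (hst : s ≤ t) (β : Ordinal) :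
    D.fib (nodeHeight t) β (D.ι t) ⊆ D.fib (nodeHeight s) β (D.ι s) := by
  rintro x ⟨hx, hxt⟩
  refine ⟨hx, ?_⟩
  rw [← trunc_trunc (nodeHeight_strictMono.monotone hst), hxt, trunc_ι hst]

lemma exists_node_fib_subset (h : IsNormalSuslin T) {β : Ordinal} {C : Set (T → unitInterval)}
    (hCβ : C ⊆ D.space β) (hC : IsConnected C) (hCc : IsClosed C) (hn : C.Nontrivial) :
    ∃ t, nodeHeight t ≤ β ∧ (trunc (nodeHeight t) '' C).Nontrivial ∧
      D.fib (nodeHeight t) β (D.ι t) ⊆ C := by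
  obtain ⟨t, ht, htn, htC⟩ := exists_node_mem_image h hCβ hC hn
  exact ⟨t, ht, htn, fun x hx => mem_of_trunc_mem_image h ht hCβ hC hCc htn hx.1 (hx.2.symm ▸ htC)⟩

/-- If the nodes attached to two members are comparable, the fibre over the upper node lies in both;
so disjoint members give an antichain. -/
lemma countable_of_pairwiseDisjoint (h : IsNormalSuslin T) {β : Ordinal}
    {𝒞 : Set (Set (T → unitInterval))}
    (h𝒞 : ∀ C ∈ 𝒞, C ⊆ D.space β ∧ IsConnected C ∧ IsClosed C ∧ C.Nontrivial)
    (hd : 𝒞.PairwiseDisjoint id) : 𝒞.Countable := by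
  have hex : ∀ C : Set (T → unitInterval), ∃ t, C ∈ 𝒞 →
      nodeHeight t ≤ β ∧ D.fib (nodeHeight t) β (D.ι t) ⊆ C := by
    intro C
    by_cases hC : C ∈ 𝒞
    · obtain ⟨hCβ, hCc, hCl, hCn⟩ := h𝒞 C hC
      obtain ⟨t, ht, -, htC⟩ := exists_node_fib_subset h hCβ hCc hCl hCn
      exact ⟨t, fun _ => ⟨ht, htC⟩⟩
    · exact ⟨h.nonempty.some, fun hC' => absurd hC' hC⟩
  choose f hf using hex
  have key : ∀ C ∈ 𝒞, ∀ C' ∈ 𝒞, f C ≤ f C' → C = C' := by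
    intro C hC C' hC' hle
    by_contra hne
    obtain ⟨x, hx⟩ := fib_nonempty (hf C' hC').1 (ι_mem_space (D := D) (f C'))
    exact Set.disjoint_left.1 (hd hC hC' hne) ((hf C hC).2 (fib_subset_fib hle β hx))
      ((hf C' hC').2 hx)
  refine countable_of_injective_of_countable_image
    (fun C hC C' hC' he => key C hC C' hC' he.le) (h.antichain (f '' 𝒞) ?_)
  rintro _ ⟨C, hC, rfl⟩ _ ⟨C', hC', rfl⟩ hne hle
  exact hne (congrArg f (key C hC C' hC' hle))

/-! ### Non-metrizability and failure of local connectedness -/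

lemma exists_mem_fib_apply_eq {β : Ordinal} {t : T} (ht : nodeHeight t < β) (u : unitInterval) :
    ∃ x ∈ D.fib (nodeHeight t) β (D.ι t), x t = u := by
  obtain ⟨x, hx, hxu⟩ := exists_mem_space ht.le (ι_mem_space (D := D) t) fun _ => u
  exact ⟨x, hx, hxu t le_rfl ht hx.2⟩

lemma not_secondCountable (h : IsNormalSuslin T) {C : Set (T → unitInterval)}
    (hCβ : C ⊆ D.space ω₁) (hC : IsConnected C) (hCc : IsClosed C) (hn : C.Nontrivial) :
    ¬ SecondCountableTopology C := by
  intro hsc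
  obtain ⟨t, -, -, htC⟩ := exists_node_fib_subset h hCβ hC hCc hn
  have hopen : ∀ r : T, IsOpen {p : C × C | p.1.1 r ≠ p.2.1 r} := fun r =>
    isOpen_ne_fun ((continuous_apply r).comp (continuous_subtype_val.comp continuous_fst))
      ((continuous_apply r).comp (continuous_subtype_val.comp continuous_snd))
  -- Second countability would let countably many coordinates separate the points of `C`. A fibre
  -- inside `C` over a node beyond all their heights still has two points.
  obtain ⟨R, hR, hRU⟩ := isOpen_iUnion_countable _ hopen
  obtain ⟨α, hα, hRα⟩ := exists_bound_of_countable h.chain hR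
  obtain ⟨t', htt', ht'⟩ := h.exists_ge (max_lt hα (nodeHeight_lt_omega_one h.chain t))
    (le_max_right α (nodeHeight t))
  have ht'ω := nodeHeight_lt_omega_one h.chain t'
  obtain ⟨a, ha, ha0⟩ := exists_mem_fib_apply_eq (D := D) ht'ω 0
  obtain ⟨b, hb, hb1⟩ := exists_mem_fib_apply_eq (D := D) ht'ω 1
  have haC := htC (fib_subset_fib htt' _ ha)
  have hbC := htC (fib_subset_fib htt' _ hb)
  have hab : ((⟨a, haC⟩, ⟨b, hbC⟩) : C × C) ∈ ⋃ r, {p : C × C | p.1.1 r ≠ p.2.1 r} := by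
    refine mem_iUnion.2 ⟨t', ?_⟩
    change a t' ≠ b t'
    rw [ha0, hb1]
    exact zero_ne_one
  rw [← hRU] at hab
  obtain ⟨r, hr, hrab⟩ := mem_iUnion₂.1 hab
  refine hrab (trunc_eq_trunc_iff.1 (ha.2.trans hb.2.symm) r ?_)
  rw [ht']
  exact lt_max_of_lt_left (hRα r hr)

lemma not_locallyConnectedSpace (h : IsNormalSuslin T) {C : Set (T → unitInterval)}
    (hCβ : C ⊆ D.space ω₁) (hC : IsConnected C) (hCc : IsClosed C) (hn : C.Nontrivial) :
    ¬ LocallyConnectedSpace C := by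
  intro hlc
  obtain ⟨t, -, htn, htC⟩ := exists_node_fib_subset h hCβ hC hCc hn
  have htω := nodeHeight_lt_omega_one h.chain t
  obtain ⟨p, hp, hp0⟩ := exists_mem_fib_apply_eq (D := D) htω 0
  obtain ⟨b, hb, hb1⟩ := exists_mem_fib_apply_eq (D := D) htω 1
  have hcont : Continuous fun x : C => x.1 t := (continuous_apply t).comp continuous_subtype_val
  have hV : {x : C | x.1 t < 1} ∈ 𝓝 (⟨p, htC hp⟩ : C) := by
    refine (isOpen_lt hcont continuous_const).mem_nhds ?_
    change p t < 1
    rw [hp0]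
    exact zero_lt_one
  obtain ⟨W, ⟨hWo, hpW, hWc⟩, hWV⟩ := (LocallyConnectedSpace.open_connected_basis _).mem_iff.1 hV
  obtain ⟨O, hO, rfl⟩ := isOpen_induced_iff.1 hWo
  -- A connected neighbourhood `W` of `p` on which coordinate `t` is below `1` contains a whole
  -- fibre by atomicity. Over `ι t` this fibre has a point with coordinate `1`; over any other
  -- point, distances in `W` fill an interval from `0`, and the oscillation reaches `1`.
  obtain ⟨_, ⟨c, hc, rfl⟩, hcO⟩ := exists_fib_subset h htω.le
    (by rintro _ ⟨c, hc, rfl⟩; exact trunc_mem_space htω.le (hCβ hc))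
    (hC.image _ (continuous_trunc _).continuousOn) htn hO hp.1 hpW ⟨p, htC hp, rfl⟩
  have hρc : Continuous fun x : C => D.ρ t x.1 (D.ι t) :=
    ((D.isCoordDist t).continuous _).comp continuous_subtype_val
  by_cases hct : trunc (nodeHeight t) c = D.ι t
  · have : b t < 1 := hWV (show (⟨b, htC hb⟩ : C) ∈ _ from hcO ⟨hb.1, hb.2.trans hct.symm⟩)
    exact this.ne hb1
  · have hpos : 0 < D.ρ t c (D.ι t) :=
      lt_of_le_of_ne ((D.isCoordDist t).nonneg _ _) fun e => hct (ρ_eq_zero_iff.1 e.symm)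
    obtain ⟨r, hr0, hrc, hr1⟩ := exists_osc_eq 1 hpos
    obtain ⟨x, hxW, hxr⟩ := hWc.isPreconnected.intermediate_value hpW
      (show (⟨c, hc⟩ : C) ∈ _ from hcO ⟨hCβ hc, rfl⟩) hρc.continuousOn
      (show r ∈ Set.Icc _ _ by
        rw [ρ_eq_zero_iff.2 hp.2]
        exact ⟨hr0.le, hrc.le⟩)
    have hxr' : D.ρ t x.1 (D.ι t) = r := hxr
    have hx1 : x.1 t = 1 := by
      rw [eq_osc (hCβ x.2) htω fun e => ?_, hxr', hr1]
      rw [← ρ_eq_zero_iff, hxr'] at e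
      exact hr0.ne' e
    exact (show x.1 t < 1 from hWV hxW).ne hx1

/-! ### Hereditary separability -/

/-- Atomicity over the arc at `t` finds a fibre inside `O`. The base points of such fibres form an
open set, and the codes of children are dense in the arc. -/
lemma exists_child_fib_subset (h : IsNormalSuslin T) {t : T} {O : Set (T → unitInterval)}
    (hO : IsOpen O) {x : T → unitInterval} (hx : x ∈ D.fib (nodeHeight t) ω₁ (D.ι t))
    (hxO : x ∈ O) : ∃ c, t ⋖ c ∧ D.fib (nodeHeight c) ω₁ (D.ι c) ⊆ O := by
  have htω := nodeHeight_lt_omega_one h.chain t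
  have hsω : Order.succ (nodeHeight t) ≤ ω₁ := Order.succ_le_of_lt htω
  obtain ⟨a, ha, ha0⟩ := exists_mem_fib_apply_eq (D := D) (Order.lt_succ (nodeHeight t)) 0
  obtain ⟨b, hb, hb1⟩ := exists_mem_fib_apply_eq (D := D) (Order.lt_succ (nodeHeight t)) 1
  have hZn : (D.fib (nodeHeight t) (Order.succ (nodeHeight t)) (D.ι t)).Nontrivial :=
    ⟨a, ha, b, hb, fun e => zero_ne_one (α := unitInterval) (by rw [← ha0, ← hb1, e])⟩
  have hxZ : trunc (Order.succ (nodeHeight t)) x ∈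
      D.fib (nodeHeight t) (Order.succ (nodeHeight t)) (D.ι t) := by
    rw [fib_eq_inter_preimage (Order.le_succ _) hsω] at hx
    exact hx.2
  obtain ⟨z, hz, hzO⟩ := exists_fib_subset h hsω (fun _ hz => hz.1)
    (isConnected_fib_succ h (ι_mem_space t)) hZn hO hx.1 hxO hxZ
  obtain ⟨_, hcO, c, hc, rfl⟩ := mem_closure_iff.1 (fib_succ_subset_closure h t hz) _
    (isOpen_fib_subset (D := D) (Order.succ (nodeHeight t)) ω₁ hO) hzO
  refine ⟨c, hc, ?_⟩
  rw [nodeHeight_of_covBy hc]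
  exact hcO

/-- Truncation factors through a cube with countably many coordinates, whose subspaces are
separable. -/
lemma exists_countable_trunc_dense (h : IsNormalSuslin T) {α : Ordinal.{0}} (hα : α < ω₁)
    (A : Set (T → unitInterval)) : ∃ E ⊆ A, E.Countable ∧
      ∀ x ∈ A, ∀ O, IsOpen O → trunc α x ∈ O → ∃ e ∈ E, trunc α e ∈ O := by
  have := (countable_nodeHeight_lt h.antichain hα).to_subtype
  let L : Set T := {t | nodeHeight t < α}
  let g : (T → unitInterval) → L → unitInterval := fun x r => x r
  let k : (L → unitInterval) → T → unitInterval := fun y r =>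
    if hr : nodeHeight r < α then y ⟨r, hr⟩ else 0
  have hk : Continuous k := by
    refine continuous_pi fun r => ?_
    by_cases hr : nodeHeight r < α
    · simpa only [k, dif_pos hr] using continuous_apply (⟨r, hr⟩ : L)
    · simpa only [k, dif_neg hr] using continuous_const
  have hkg : ∀ x, k (g x) = trunc α x := by
    intro x
    funext r
    by_cases hr : nodeHeight r < α
    · simp only [k, dif_pos hr, trunc_apply_of_lt x hr, g]
    · simp only [k, dif_neg hr, trunc_apply_of_le x (not_lt.1 hr)]
  obtain ⟨E₀, hE₀, hE₀d⟩ := TopologicalSpace.exists_countable_dense (g '' A)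
  have hex : ∀ y : g '' A, ∃ x ∈ A, g x = y := fun y => y.2
  choose f hfA hf using hex
  refine ⟨f '' E₀, ?_, hE₀.image f, fun x hx O hO hxO => ?_⟩
  · rintro _ ⟨y, -, rfl⟩
    exact hfA y
  · obtain ⟨y, hyO, hy⟩ := hE₀d.inter_open_nonempty (Subtype.val ⁻¹' (k ⁻¹' O))
      ((hO.preimage hk).preimage continuous_subtype_val)
      ⟨⟨g x, x, hx, rfl⟩, show k (g x) ∈ O by rwa [hkg]⟩
    refine ⟨f y, ⟨y, hy, rfl⟩, ?_⟩
    rw [← hkg, hf]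
    exact hyO

theorem exists_countable_dense_subset (h : IsNormalSuslin T) {A : Set (T → unitInterval)}
    (hA : A ⊆ D.space ω₁) : ∃ E ⊆ A, E.Countable ∧ A ⊆ closure E := by
  let G : Set T := {t | ∃ E ⊆ A, E.Countable ∧ A ∩ D.fib (nodeHeight t) ω₁ (D.ι t) ⊆ closure E}
  -- Either `A` misses the fibre over some node above `t`, or one point of `A` over each child of
  -- `t` suffices.
  have hG : ∀ t, ∃ t', t ≤ t' ∧ t' ∈ G := by
    intro t
    by_cases hemp : ∃ t', t ≤ t' ∧ ¬ (A ∩ D.fib (nodeHeight t') ω₁ (D.ι t')).Nonempty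
    · obtain ⟨t', htt', ht'⟩ := hemp
      refine ⟨t', htt', ∅, empty_subset _, countable_empty, ?_⟩
      rw [not_nonempty_iff_eq_empty.1 ht']
      exact empty_subset _
    · push Not at hemp
      have hex : ∀ c, ∃ x, t ≤ c → x ∈ A ∩ D.fib (nodeHeight c) ω₁ (D.ι c) := fun c => by
        by_cases hc : t ≤ c
        · obtain ⟨x, hx⟩ := hemp c hc
          exact ⟨x, fun _ => hx⟩
        · exact ⟨0, fun hc' => absurd hc' hc⟩
      choose f hf using hex
      refine ⟨t, le_rfl, f '' {c | t ⋖ c}, ?_, (h.countable_children t).image f, ?_⟩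
      · rintro _ ⟨c, hc, rfl⟩
        exact (hf c (show t ⋖ c from hc).le).1
      · rintro x ⟨-, hx⟩
        refine mem_closure_iff.2 fun O hO hxO => ?_
        obtain ⟨c, hc, hcO⟩ := exists_child_fib_subset h hO hx hxO
        exact ⟨f c, hcO (hf c hc.le).2, c, hc, rfl⟩
  -- `G` is upward closed and cofinal. Its minimal nodes form a countable antichain, so beyond a
  -- bound `α` for their heights every node is in `G`.
  obtain ⟨α, hα, hbd⟩ := exists_bound_of_countable h.chain
    (h.antichain _ (isAntichain_minimal G))
  have hGα : ∀ t, nodeHeight t = α → t ∈ G := by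
    intro t ht
    obtain ⟨t', htt', ht'⟩ := hG t
    obtain ⟨m, hmG, hmt', hmin⟩ := exists_minimal_le_mem ht'
    have hmt : m ≤ t := le_of_nodeHeight_le hmt' htt' (ht ▸ (hbd m ⟨hmG, hmin⟩).le)
    obtain ⟨E, hEA, hE, hEc⟩ := hmG
    exact ⟨E, hEA, hE, (inter_subset_inter_right A (fib_subset_fib hmt ω₁)).trans hEc⟩
  have hex : ∀ t, ∃ E ⊆ A, E.Countable ∧
      (nodeHeight t = α → A ∩ D.fib (nodeHeight t) ω₁ (D.ι t) ⊆ closure E) := by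
    intro t
    by_cases ht : nodeHeight t = α
    · obtain ⟨E, hEA, hE, hEc⟩ := hGα t ht
      exact ⟨E, hEA, hE, fun _ => hEc⟩
    · exact ⟨∅, empty_subset _, countable_empty, fun ht' => absurd ht' ht⟩
  choose E hEA hE hEc using hex
  obtain ⟨E₀, hE₀A, hE₀, hE₀d⟩ := exists_countable_trunc_dense h hα A
  refine ⟨E₀ ∪ ⋃ t ∈ treeLevel T α, E t, union_subset hE₀A (iUnion₂_subset fun t _ => hEA t),
    hE₀.union ((h.antichain _ (isAntichain_treeLevel α)).biUnion fun t _ => hE t), fun x hx => ?_⟩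
  by_cases hs : ∃ s, nodeHeight s = α ∧ D.ι s = trunc α x
  · obtain ⟨s, rfl, hsx⟩ := hs
    refine closure_mono ?_ (hEc s rfl ⟨hx, hA hx, hsx.symm⟩)
    exact (subset_biUnion_of_mem (u := E) (show s ∈ treeLevel T (nodeHeight s) from rfl)).trans
      subset_union_right
  · push Not at hs
    refine closure_mono subset_union_left (mem_closure_iff.2 fun O hO hxO => ?_)
    obtain ⟨e, he, heO⟩ := hE₀d x hx _ (isOpen_fib_subset (D := D) α ω₁ hO) (by
      change D.fib α ω₁ (trunc α x) ⊆ O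
      rw [fib_eq_singleton hs ⟨hA hx, rfl⟩]
      exact singleton_subset_iff.2 hxO)
    exact ⟨e, heO ⟨hA (hE₀A he), rfl⟩, he⟩

end TreeCoding

end Subcontinua

/-! ### The spectrum -/

section SubtypeTransfer

variable {E : Type*} [TopologicalSpace E] {S : Set E}

lemma IsConnected.preimage_subtype_val {s : Set E} (hs : IsConnected s) (h : s ⊆ S) :
    IsConnected (Subtype.val ⁻¹' s : Set S) := by
  have himg : (Subtype.val '' (Subtype.val ⁻¹' s : Set S)) = s := by
    rw [Subtype.image_preimage_coe, inter_eq_right.2 h]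
  refine ⟨?_, ?_⟩
  · obtain ⟨x, hx⟩ := hs.nonempty
    exact ⟨⟨x, h hx⟩, hx⟩
  · rw [← Topology.IsInducing.subtypeVal.isPreconnected_image, himg]
    exact hs.isPreconnected

lemma IsContinuum.isConnected {C : Set E} (h : IsContinuum C) : IsConnected C :=
  isConnected_iff_connectedSpace.2 h.connectedSpace

lemma IsNondegenerateSubcontinuum.image_val [T2Space E] {C : Set S}
    (h : IsNondegenerateSubcontinuum C) : (Subtype.val '' C : Set E) ⊆ S ∧
      IsConnected (Subtype.val '' C) ∧ IsClosed (Subtype.val '' C) ∧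
      (Subtype.val '' C).Nontrivial :=
  ⟨by rintro _ ⟨c, -, rfl⟩; exact c.2,
    h.1.isConnected.image _ continuous_subtype_val.continuousOn,
    ((isCompact_iff_compactSpace.2 h.1.compactSpace).image continuous_subtype_val).isClosed,
    h.2.image Subtype.val_injective⟩

end SubtypeTransfer

lemma CountableOrdinal.succ_eq_of_covBy {α β : CountableOrdinal} (h : α ⋖ β) :
    β.1 = Order.succ α.1 := by
  have hlt : α.1 < β.1 := h.1
  refine le_antisymm ?_ (Order.succ_le_of_lt hlt)
  by_contra hcon
  exact h.2 (c := ⟨Order.succ α.1, (Order.succ_le_of_lt hlt).trans_lt β.2⟩)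
    (Order.lt_succ α.1) (not_le.1 hcon)

section Spectrum

variable {T : Type} [PartialOrder T] [IsSetTree T] {D : TreeCoding T}

namespace TreeCoding

lemma isContinuum_space (h : IsNormalSuslin T) (β : Ordinal) : IsContinuum (D.space β) where
  compactSpace := isCompact_iff_compactSpace.1 (isCompact_space β)
  connectedSpace := by
    have h0 : (fun _ => 0 : T → unitInterval) ∈ D.space 0 :=
      ⟨fun r hr => absurd hr (not_lt.2 zero_le), fun _ _ => rfl⟩
    have : D.fib 0 β (fun _ => 0) = D.space β := by
      refine Subset.antisymm (fun x hx => hx.1) fun x hx => ⟨hx, ?_⟩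
      funext r
      exact trunc_apply_of_le x zero_le
    rw [← this]
    exact isConnected_iff_connectedSpace.1 (isConnected_fib h zero_le h0)
  t2Space := inferInstance

lemma isSuslinianContinuum_space (h : IsNormalSuslin T) (β : Ordinal) :
    IsSuslinianContinuum (D.space β) := by
  refine ⟨isContinuum_space h β, fun 𝒞 h𝒞 hd => ?_⟩
  have hinj : Function.Injective fun C : Set (D.space β) => (Subtype.val '' C : Set _) :=
    Set.image_injective.2 Subtype.val_injective
  refine countable_of_injective_of_countable_image hinj.injOn
    (countable_of_pairwiseDisjoint (D := D) (β := β) h ?_ ?_)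
  · rintro _ ⟨C, hC, rfl⟩
    exact (h𝒞 C hC).image_val
  · rintro _ ⟨C, hC, rfl⟩ _ ⟨C', hC', rfl⟩ hne
    exact (Set.disjoint_image_iff Subtype.val_injective).2
      (hd hC hC' fun e => hne (by rw [e]))

lemma isHereditarilySeparable_space (h : IsNormalSuslin T) :
    IsHereditarilySeparable (D.space ω₁) := by
  intro A
  obtain ⟨E, hEA, hE, hAE⟩ := exists_countable_dense_subset (D := D) h
    (A := Subtype.val '' A) (by rintro _ ⟨a, -, rfl⟩; exact a.2)
  let v : A → T → unitInterval := fun a => a.1.1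
  have hv : Topology.IsInducing v :=
    Topology.IsInducing.subtypeVal.comp Topology.IsInducing.subtypeVal
  refine ⟨⟨v ⁻¹' E, hE.preimage (Subtype.val_injective.comp Subtype.val_injective), fun a => ?_⟩⟩
  have himg : v '' (v ⁻¹' E) = E := by
    refine Set.image_preimage_eq_of_subset fun e he => ?_
    obtain ⟨a, ha, rfl⟩ := hEA he
    exact ⟨⟨a, ha⟩, rfl⟩
  rw [hv.closure_eq_preimage_closure_image, himg]
  exact hAE ⟨a.1, a.2, rfl⟩

lemma subcontinuum_space (h : IsNormalSuslin T) {C : Set (D.space ω₁)}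
    (hC : IsNondegenerateSubcontinuum C) :
    ¬ MetrizableSpace C ∧ ¬ LocallyConnectedSpace C := by
  obtain ⟨h1, h2, h3, h4⟩ := hC.image_val
  let e : C ≃ₜ (Subtype.val '' C : Set (T → unitInterval)) :=
    Topology.IsEmbedding.subtypeVal.homeomorphImage C
  have := hC.1.compactSpace
  constructor
  · intro hm
    let _ : MetricSpace C := metrizableSpaceMetric C
    exact not_secondCountable h h1 h2 h3 h4 e.symm.isEmbedding.secondCountableTopology
  · intro hl
    exact not_locallyConnectedSpace h h1 h2 h3 h4 e.symm.isOpenEmbedding.locallyConnectedSpace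

lemma not_metrizableSpace_space (h : IsNormalSuslin T) : ¬ MetrizableSpace (D.space ω₁) := by
  intro hm
  have hc := isContinuum_space (D := D) h ω₁
  have := hc.compactSpace
  have hconn := hc.connectedSpace
  obtain ⟨t⟩ := h.nonempty
  have htω := nodeHeight_lt_omega_one h.chain t
  obtain ⟨a, ha, ha0⟩ := exists_mem_fib_apply_eq (D := D) htω 0
  obtain ⟨b, hb, hb1⟩ := exists_mem_fib_apply_eq (D := D) htω 1
  refine (subcontinuum_space h (C := (Set.univ : Set (D.space ω₁))) ⟨⟨?_, ?_, inferInstance⟩,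
    ⟨⟨a, ha.1⟩, trivial, ⟨b, hb.1⟩, trivial, fun e => ?_⟩⟩).1 inferInstance
  · exact isCompact_iff_compactSpace.1 isCompact_univ
  · exact isConnected_iff_connectedSpace.1 isConnected_univ
  · have hab : a t = b t := congrArg (fun x : D.space ω₁ => x.1 t) e
    rw [ha0, hb1] at hab
    exact zero_ne_one hab

lemma metrizableSpace_space (h : IsNormalSuslin T) {α : Ordinal.{0}} (hα : α < ω₁) :
    MetrizableSpace (D.space α) := by
  have := (countable_nodeHeight_lt h.antichain hα).to_subtype
  have := (isContinuum_space (D := D) h α).compactSpace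
  let g : D.space α → {t : T | nodeHeight t < α} → unitInterval := fun x r => x.1 r
  have hg : Continuous g :=
    continuous_pi fun r => (continuous_apply r.1).comp continuous_subtype_val
  refine (hg.isClosedEmbedding fun x y hxy => Subtype.ext (funext fun r => ?_)).isEmbedding.metrizableSpace
  by_cases hr : nodeHeight r < α
  · exact congrFun hxy ⟨r, hr⟩
  · rw [x.2.2 r (not_lt.1 hr), y.2.2 r (not_lt.1 hr)]

variable (D) in
/-- The projection from the `β`-th to the `α`-th space of the spectrum. -/
noncomputable def proj (α β : Ordinal) (h : α ≤ β) (x : D.space β) : D.space α :=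
  ⟨trunc α x.1, trunc_mem_space h x.2⟩

lemma continuous_proj {α β : Ordinal} (h : α ≤ β) : Continuous (D.proj α β h) :=
  ((continuous_trunc α).comp continuous_subtype_val).subtype_mk _

lemma proj_preimage_singleton {α β : Ordinal} (h : α ≤ β) (y : D.space α) :
    D.proj α β h ⁻¹' {y} = Subtype.val ⁻¹' D.fib α β y.1 := by
  ext x
  exact ⟨fun hx => ⟨x.2, congrArg Subtype.val hx⟩, fun hx => Subtype.ext hx.2⟩

lemma isAtomicMap_proj (hT : IsNormalSuslin T) {α β : Ordinal} (h : α ≤ β) :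
    IsAtomicMap (D.proj α β h) where
  continuous := continuous_proj h
  connected_fiber y := by
    rw [proj_preimage_singleton]
    exact (isConnected_fib hT h y.2).preimage_subtype_val fun _ hx => hx.1
  irreducible Z hZ := by
    constructor
    · rintro ⟨y, hy⟩
      obtain ⟨x, hx⟩ := fib_nonempty h y.2
      have hxy : D.proj α β h ⟨x, hx.1⟩ = y := Subtype.ext hx.2
      exact ⟨⟨⟨x, hx.1⟩, show D.proj α β h _ ∈ Z by rwa [hxy]⟩, Subtype.ext hxy⟩
    · intro A hA hne himg
      obtain ⟨x, hxA⟩ := (Set.ne_univ_iff_exists_notMem A).1 hne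
      obtain ⟨O', hO', hO'A⟩ := isOpen_induced_iff.1 hA.isOpen_compl
      obtain ⟨O, hO, rfl⟩ := isOpen_induced_iff.1 hO'
      obtain ⟨hZα, hZc, -, hZn⟩ := hZ.image_val
      have hmem : ∀ a : D.proj α β h ⁻¹' Z, a.1.1 ∈ O → a ∉ A := fun a ha =>
        show a ∈ Aᶜ from hO'A ▸ ha
      have hxO : x ∈ Aᶜ := hxA
      rw [← hO'A] at hxO
      -- A closed set omitting `x` omits a whole fibre over some `z ∈ Z`, so it cannot map onto `Z`.
      obtain ⟨_, ⟨z, hz, rfl⟩, hzO⟩ := exists_fib_subset hT h hZα hZc hZn hO x.1.2 hxO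
        ⟨_, x.2, rfl⟩
      obtain ⟨a, haA, ha⟩ : (⟨z, hz⟩ : Z) ∈ Z.restrictPreimage (D.proj α β h) '' A := by
        rw [himg]; trivial
      refine hmem a (hzO ⟨a.1.2, ?_⟩) haA
      exact congrArg (fun w : Z => w.1.1) ha

lemma isIAtomicMap_proj (hT : IsNormalSuslin T) {α β : Ordinal} (h : α ≤ β)
    (hβ : β = Order.succ α) : IsIAtomicMap (D.proj α β h) := by
  classical
  subst hβ
  refine ⟨isAtomicMap_proj hT h, fun y => ?_⟩
  rw [proj_preimage_singleton]
  obtain ⟨x, hx⟩ := fib_nonempty h y.2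
  by_cases hs : ∃ s, nodeHeight s = α ∧ D.ι s = y.1
  · right
    obtain ⟨s, rfl, hsy⟩ := hs
    rw [← hsy] at hx ⊢
    have hr := fib_succ_eq_range hT hx
    have hmem : ∀ u, Function.update x s u ∈ D.fib (nodeHeight s) (Order.succ (nodeHeight s)) (D.ι s) :=
      fun u => by rw [hr]; exact ⟨u, rfl⟩
    let f : unitInterval → (Subtype.val ⁻¹' D.fib (nodeHeight s) (Order.succ (nodeHeight s)) (D.ι s) :
        Set (D.space (Order.succ (nodeHeight s)))) := fun u => ⟨⟨Function.update x s u, (hmem u).1⟩, hmem u⟩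
    have hf : Continuous f := by
      have hc : Continuous fun u : unitInterval => Function.update x s u :=
        continuous_const.update s continuous_id
      exact (hc.subtype_mk _).subtype_mk _
    have hbij : Function.Bijective f := by
      constructor
      · intro u v huv
        have : Function.update x s u s = Function.update x s v s :=
          congrArg (fun w => w.1.1 s) huv
        simpa using this
      · rintro ⟨⟨w, hw⟩, hw'⟩
        have hw'' : w ∈ D.fib (nodeHeight s) (Order.succ (nodeHeight s)) (D.ι s) := hw'
        rw [hr] at hw''
        obtain ⟨u, rfl⟩ := hw''
        exact ⟨u, rfl⟩
    exact ⟨(Continuous.homeoOfEquivCompactToT2 (f := Equiv.ofBijective f hbij) hf).symm⟩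
  · left
    push Not at hs
    refine ⟨⟨x, hx.1⟩, ?_⟩
    rw [fib_eq_singleton hs hx]
    ext w
    simp only [mem_preimage, mem_singleton_iff, Subtype.ext_iff]

lemma mem_nondegeneracySet_proj_iff {α β : Ordinal} (h : α ≤ β)
    (hβ : β = Order.succ α) (y : D.space α) :
    y ∈ nondegeneracySet (D.proj α β h) ↔ ∃ s, nodeHeight s = α ∧ D.ι s = y.1 := by
  subst hβ
  change (D.proj α _ h ⁻¹' {y}).Nontrivial ↔ _
  rw [proj_preimage_singleton]
  constructor
  · intro hn
    by_contra hs
    push Not at hs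
    obtain ⟨x, hx⟩ := fib_nonempty h y.2
    rw [fib_eq_singleton hs hx] at hn
    obtain ⟨a, ha, b, hb, hab⟩ := hn
    exact hab (Subtype.ext ((show a.1 = x from ha).trans (show b.1 = x from hb).symm))
  · rintro ⟨s, rfl, hsy⟩
    rw [← hsy]
    obtain ⟨a, ha, ha0⟩ := exists_mem_fib_apply_eq (D := D) (Order.lt_succ (nodeHeight s)) 0
    obtain ⟨b, hb, hb1⟩ := exists_mem_fib_apply_eq (D := D) (Order.lt_succ (nodeHeight s)) 1
    refine ⟨⟨a, ha.1⟩, ha, ⟨b, hb.1⟩, hb, fun e => ?_⟩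
    have hab : a = b := congrArg Subtype.val e
    rw [hab, hb1] at ha0
    exact one_ne_zero ha0

/-- The general index `I` covers both the limit stages below `ω₁` and the final space. A thread is
glued coordinatewise, and each defining condition involves only coordinates already visible at one
stage. -/
lemma isInverseLimit_proj (hT : IsNormalSuslin T) {I : Type*} [LinearOrder I] {o : I → Ordinal.{0}}
    (ho : Monotone o) {β : Ordinal.{0}} (hoβ : ∀ i, o i ≤ β) (hcof : ∀ γ < β, ∃ i, γ < o i) :
    IsInverseLimit (I := I) (X := fun i => D.space (o i)) (fun i j hij => D.proj (o i) (o j) (ho hij))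
      (fun i => D.proj (o i) β (hoβ i)) := by
  have hcpt := (isContinuum_space (D := D) hT β).compactSpace
  constructor
  · refine (Continuous.isClosedEmbedding (continuous_pi fun i => continuous_proj (hoβ i))
      fun x y hxy => Subtype.ext (funext fun r => ?_)).isEmbedding
    by_cases hr : nodeHeight r < β
    · obtain ⟨i, hi⟩ := hcof _ hr
      exact trunc_eq_trunc_iff.1 (congrArg Subtype.val (congrFun hxy i)) r hi
    · rw [x.2.2 r (not_lt.1 hr), y.2.2 r (not_lt.1 hr)]
  · ext z
    constructor
    · rintro ⟨x, rfl⟩ i j hij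
      exact Subtype.ext (trunc_trunc (ho hij) x.1)
    · intro hz
      have hz' : ∀ i j, i ≤ j → trunc (o i) (z j).1 = (z i).1 := fun i j hij =>
        congrArg Subtype.val (hz i j hij)
      have hagree : ∀ i j r, nodeHeight r < o i → nodeHeight r < o j → (z i).1 r = (z j).1 r := by
        intro i j r hi hj
        rcases le_total i j with hij | hij
        · rw [← hz' i j hij, trunc_apply_of_lt _ hi]
        · rw [← hz' j i hij, trunc_apply_of_lt _ hj]
      classical
      let x : T → unitInterval := fun r =>
        if hr : ∃ i, nodeHeight r < o i then (z hr.choose).1 r else 0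
      have hx : ∀ i r, nodeHeight r < o i → x r = (z i).1 r := by
        intro i r hr
        have hex : ∃ i, nodeHeight r < o i := ⟨i, hr⟩
        change dite _ _ _ = _
        rw [dif_pos hex]
        exact hagree _ _ r hex.choose_spec hr
      have hxtr : ∀ i, trunc (o i) x = (z i).1 := by
        intro i
        rw [← trunc_of_mem le_rfl (z i).2]
        exact trunc_eq_trunc_iff.2 (hx i)
      have hxm : x ∈ D.space β := by
        refine ⟨fun r hr => ?_, fun r hr => dif_neg ?_⟩
        · obtain ⟨i, hi⟩ := hcof _ hr
          rw [ρ_congr (x' := (z i).1) fun r' hr' => hx i r' (hr'.trans hi), hx i r hi]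
          exact (z i).2.1 r hi
        · rintro ⟨i, hi⟩
          exact absurd (hi.trans_le (hoβ i)) (not_lt.2 hr)
      exact ⟨⟨x, hxm⟩, funext fun i => Subtype.ext (hxtr i)⟩

variable (D) in
/-- The points of the `α`-th space that encode the nodes of height `α`. -/
def levelPoint (α : Ordinal) (t : treeLevel T α) : D.space α :=
  ⟨D.ι t.1, by
    obtain ⟨t, rfl⟩ := t
    exact ι_mem_space t⟩

lemma isTreeSpectrum (hT : IsNormalSuslin T) :
    IsTreeSpectrum T (fun α => D.space α.1) (fun α β h => D.proj α.1 β.1 h)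
      (fun α t => D.levelPoint α.1 t) where
  map_self α x := Subtype.ext (trunc_of_mem le_rfl x.2)
  map_map α β γ h _ x := Subtype.ext (trunc_trunc h x.1)
  metrizable α := metrizableSpace_space hT α.2
  suslinian α := isSuslinianContinuum_space hT α.1
  atomic α β h := isAtomicMap_proj hT h
  bottom α hα := by
    have h0 : α.1 = 0 := by
      have h1 : (⟨0, Ordinal.omega_pos 1⟩ : CountableOrdinal) ≤ α :=
        show (0 : Ordinal) ≤ α.1 from zero_le
      exact le_antisymm (hα h1) zero_le
    refine ⟨fun x y => Subtype.ext (funext fun r => ?_)⟩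
    have hr : α.1 ≤ nodeHeight r := h0 ▸ zero_le
    rw [x.2.2 r hr, y.2.2 r hr]
  limit α hα := by
    refine isInverseLimit_proj hT (I := Set.Iio α) (o := fun β => β.1.1) (fun _ _ h => h)
      (fun β => le_of_lt β.2) fun γ hγ => ?_
    let γ' : CountableOrdinal := ⟨γ, lt_trans hγ α.2⟩
    have hγα : γ' < α := hγ
    obtain ⟨δ, hδ, hδα⟩ := (not_covBy_iff hγα).1 (hα.isSuccPrelimit γ')
    exact ⟨⟨δ, hδα⟩, hδ⟩
  injective α s t hst := by
    refine Subtype.ext (ι_injective hT ?_ (congrArg Subtype.val hst))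
    exact (show nodeHeight s.1 = α.1 from s.2).trans (show nodeHeight t.1 = α.1 from t.2).symm
  commutes α β h s t hst := by
    have hs : nodeHeight s.1 = α.1 := s.2
    exact Subtype.ext ((congrArg (fun γ => trunc γ (D.ι t.1)) hs.symm).trans (trunc_ι hst))
  iAtomic α β h := isIAtomicMap_proj hT h.le (CountableOrdinal.succ_eq_of_covBy h)
  nondegeneracySet_eq α β h := by
    ext y
    rw [mem_nondegeneracySet_proj_iff h.le (CountableOrdinal.succ_eq_of_covBy h)]
    constructor
    · rintro ⟨s, hs, hsy⟩
      exact ⟨⟨s, hs⟩, Subtype.ext hsy⟩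
    · rintro ⟨s, rfl⟩
      exact ⟨s.1, s.2, rfl⟩
  dense α β h s := by
    have hs : nodeHeight s.1 = α.1 := s.2
    have hβ := CountableOrdinal.succ_eq_of_covBy h
    rw [proj_preimage_singleton]
    have himg : Subtype.val '' (D.levelPoint β.1 '' {t | s.1 < t.1}) = D.ι '' {c | s.1 ⋖ c} := by
      ext x
      constructor
      · rintro ⟨_, ⟨t, ht, rfl⟩, rfl⟩
        refine ⟨t.1, covBy_of_nodeHeight ht ?_, rfl⟩
        rw [hs, ← hβ]
        exact t.2
      · rintro ⟨c, hc, rfl⟩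
        exact ⟨_, ⟨⟨c, by rw [hβ, ← hs]; exact nodeHeight_of_covBy hc⟩, hc.1, rfl⟩, rfl⟩
    rw [Topology.IsInducing.subtypeVal.closure_eq_preimage_closure_image, himg]
    have hfib : D.fib α.1 β.1 (D.levelPoint α.1 s).1 =
        D.fib (nodeHeight s.1) (Order.succ (nodeHeight s.1)) (D.ι s.1) := by
      rw [hβ]
      exact congrArg (fun γ => D.fib γ (Order.succ γ) (D.ι s.1)) hs.symm
    rw [hfib]
    refine congrArg _ (Subset.antisymm (closure_minimal ?_ (isClosed_fib _ _ _))
      (fib_succ_subset_closure hT s.1))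
    rintro _ ⟨c, hc, rfl⟩
    exact ι_mem_fib_succ hc

end TreeCoding

end Spectrum

theorem mainTheorem5 (hSH : ¬ SuslinHypothesis) :
    ∃ (X : Type) (_ : TopologicalSpace X),
      IsSuslinianContinuum X ∧ IsHereditarilySeparable X ∧ ¬ MetrizableSpace X ∧
      (∀ C : Set X, IsNondegenerateSubcontinuum C →
        ¬ MetrizableSpace C ∧ ¬ LocallyConnectedSpace C) ∧
      ∃ (T : Type) (_ : PartialOrder T) (_ : IsSetTree T)
        (Y : CountableOrdinal → Type) (_ : ∀ α, TopologicalSpace (Y α))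
        (π : ∀ α β : CountableOrdinal, α ≤ β → Y β → Y α)
        (ι : ∀ α : CountableOrdinal, treeLevel T α.1 → Y α)
        (p : ∀ α : CountableOrdinal, X → Y α),
        IsSuslinTree T ∧ IsTreeSpectrum T Y π ι ∧ IsInverseLimit π p := by
  obtain ⟨T, _, _, hT⟩ := exists_isNormalSuslin hSH
  obtain ⟨D⟩ := hT.nonempty_treeCoding
  refine ⟨D.space ω₁, inferInstance, TreeCoding.isSuslinianContinuum_space hT ω₁,
    TreeCoding.isHereditarilySeparable_space hT, TreeCoding.not_metrizableSpace_space hT,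
    fun C hC => TreeCoding.subcontinuum_space hT hC, T, inferInstance, inferInstance, _, _, _, _, _,
    hT.toIsSuslinLike.isSuslinTree, TreeCoding.isTreeSpectrum (D := D) hT,
    TreeCoding.isInverseLimit_proj hT (I := CountableOrdinal) (o := fun α => α.1) (β := ω₁)
      (fun _ _ h => h) (fun α => le_of_lt α.2) fun γ hγ => ?_⟩
  exact ⟨⟨Order.succ γ, (Cardinal.isSuccLimit_omega 1).succ_lt hγ⟩, Order.lt_succ γ⟩
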